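/- **Setting.** Let $D\subset\mathbb R^3$ be open and let $g_t:D\to\mathbb R^3$, $t\in\mathbb R$, be volume preserving embeddings, smooth in $(t,x)$, with $g_0=\mathrm{id}$ and smooth Eulerian velocity $\mathbf v$, i.e. $\frac{d}{dt}g_t(x)=\mathbf v(t,g_t(x))$. Put $M=\{(t,g_t(x)):t\in\mathbb R,\ x\in D\}\subset\mathbb R\times\mathbb R^3$. On $M$ let $\mathbf B$ be a smooth divergence-free field and $\varphi,h$ smooth functions with $$\partial_t\mathbf B-\nabla\times(\mathbf v\times\mathbf B)=0,\qquad \partial_t\varphi+\mathbf v\cdot\nabla\varphi=0,\qquad \partial_t h+\mathbf v\cdot\nabla h=0,\qquad -\mathbf B\cdot\nabla\varphi=1 .$$ Put $\hat{\mathbf u}_0=\mathbf B$, $\hat{\mathbf u}_1=\nabla\varphi\times\nabla h$ and $\hat{\mathbf u}_2=\nabla\times(\hat{\mathbf u}_1\times\hat{\mathbf u}_0)$, $\hat{\mathbf u}_k=\nabla\times(\hat{\mathbf u}_1\times\hat{\mathbf u}_{k-1})$ for $k\ge3$. Let $\mathbf A_k,\psi_k$ $(k\ge0)$ be any smooth potentials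 on $M$ with $\nabla\times\mathbf A_k=\hat{\mathbf u}_k$, $\ \partial_t\mathbf A_0-\mathbf v\times(\nabla\times\mathbf A_0)=\nabla(\varphi+\psi_0)$, and $\partial_t\mathbf A_k+\hat{\mathbf u}_k\times\mathbf v=\nabla\psi_k$ for $k\ge1$. Define $$\theta_0=-(\psi_0\,dt+\mathbf A_0\cdot d\mathbf x),\quad \chi_0=-(\psi_0+\varphi+\mathbf v\cdot\mathbf A_0),\quad \Theta_0=\Omega=-(\nabla\varphi+\mathbf v\times\mathbf B)\cdot d\mathbf x\wedge dt+\mathbf B\cdot(d\mathbf x\wedge d\mathbf x),$$ and for $k\ge1$ $$\theta_k=\psi_k\,dt+\mathbf A_k\cdot d\mathbf x,\quad \chi_k=\psi_k+\mathbf v\cdot\mathbf A_k,\quad \Theta_k=-\hat{\mathbf u}_k\cdot d\mathbf x\wedge d\mathbf x-(\hat{\mathbf u}_k\times\mathbf v)\cdot d\mathbf x\wedge dt .$$ Let $S_t$ and $D_t$ be two- and three-dimensional regions in $\mathbb R\times\mathbb R^3$ (smooth singular chains, with their usual oriented boundaries) advected by the flow: $S_t$ is the image of a region $S$ in $\mathbb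 R\times D$ under $(\tau,x)\mapsto(\tau+t,g_{\tau+t}(x))$, and likewise $D_t$. In particular, time slices $\{t\}\times g_t(S)$ are allowed. **Proposition (general conservation laws).** On $M$, $\Theta_k=-d\theta_k$ for all $k\ge0$, and for all $k,l\ge 0$ and all $t\in\mathbb R$: (1) $\displaystyle \int_{S_t}\Theta_k=-\oint_{\partial S_t}\theta_k$ and $$\frac{d}{dt}\int_{S_t}\Theta_k=-\frac{d}{dt}\oint_{\partial S_t}\theta_k=-\oint_{\partial S_t}d\chi_k=0 .$$ (2) $\displaystyle \frac{d}{dt}\int_{D_t}\theta_k\wedge d\theta_l=\oint_{\partial D_t}\chi_k\,d\theta_l=-\oint_{\partial D_t}d\chi_k\wedge\theta_l$. The derivative is $0$ if $\chi_k$ is constant on $M$. It is also $0$ at time $t$ if $\hat{\mathbf u}_l$ is tangent to the projection of $\partial D_t$ onto $\mathbb R^3$ and either $D_t$ lies in a time slice, or $l\ge1$ and $\mathbf v$ is tangent to that projection as well. (A spatial field is tangent to the projection if, wherever $\partial D_t$ is immersed, it lies in the projection of the tangent plane.) (3) If $\hat{\mathbf u}_l\cdot\nabla\chi_k=0$ on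 $M$, i.e. $\hat{\mathbf u}_l$ is tangent to the surfaces $\chi_k=\text{constant}$, then the generalized helicity density $f$, the $dx\wedge dy\wedge dz$ coefficient of $\theta_k\wedge d\theta_l$, is a Lagrangian invariant: it is smooth and $\partial_tf+\mathbf v\cdot\nabla f=0$ on $M$. The Lagrangian invariants form a Poisson algebra under the bracket $\{f,g\}_\varphi=\nabla\varphi\cdot\nabla f\times\nabla g$, to which these densities therefore belong. It contains the generalized potential vorticities $h_1=h$, $h_2=\mathbf B\cdot\nabla h$, $h_k=-\hat{\mathbf u}_1\cdot\nabla h_{k-1}$ $(k\ge3)$. Moreover, if $k\ge1$ and $\mathbf A_k$ is the explicit potential ($\mathbf A_1=\varphi\nabla h$, $\mathbf A_2=\hat{\mathbf u}_1\times\hat{\mathbf u}_0$, $\mathbf A_k=\hat{\mathbf u}_1\times\hat{\mathbf u}_{k-1}$ for $k\ge3$), then for every $l\ge 0$ the density of $\theta_k\wedge d\theta_l$ belongs to the Poisson algebra generated by $\varphi$ and $h_1,h_2,\dots$ -/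

import Mathlib

open Set
open scoped Matrix ContDiff

noncomputable section

namespace VorticityConservation

/-! ### Vector calculus on `ℝ × ℝ³` -/

/-- The flow space `ℝ³`. Only its smooth structure and the coordinate dot and cross products
are used. -/
abbrev R3 : Type := Fin 3 → ℝ

/-- The time-extended space `ℝ × ℝ³` with points `(t, x)`. -/
abbrev SpaceTime : Type := ℝ × R3

/-- The spatial coordinate vector `(0, e_i)`. -/
def spaceBasis (i : Fin 3) : SpaceTime := (0, Pi.single i 1)

/-- `∂F/∂t`, for a scalar or vector valued function `F` of `(t, x)`. -/
def dt {V : Type} [NormedAddCommGroup V] [NormedSpace ℝ V] (F : SpaceTime → V) :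
    SpaceTime → V :=
  fun p => fderiv ℝ F p (1, 0)

/-- The spatial gradient `∇f`. -/
def grad (f : SpaceTime → ℝ) : SpaceTime → R3 :=
  fun p i => fderiv ℝ f p (spaceBasis i)

/-- The partial derivative `∂F_j/∂x_i` of a vector field. -/
def partialD (F : SpaceTime → R3) (i j : Fin 3) : SpaceTime → ℝ :=
  fun p => fderiv ℝ F p (spaceBasis i) j

/-- The spatial divergence `∇ · F`. -/
def divergence (F : SpaceTime → R3) : SpaceTime → ℝ :=
  fun p => ∑ i, partialD F i i p

/-- The spatial curl `∇ × F`. -/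
def curl (F : SpaceTime → R3) : SpaceTime → R3 :=
  fun p => ![partialD F 1 2 p - partialD F 2 1 p,
             partialD F 2 0 p - partialD F 0 2 p,
             partialD F 0 1 p - partialD F 1 0 p]

/-- The pointwise cross product of two vector fields. -/
def cross (F G : SpaceTime → R3) : SpaceTime → R3 := fun p => F p ⨯₃ G p

/-- The action `w(f) = w · ∇f` of a spatial vector field on functions. -/
def along (w : SpaceTime → R3) (f : SpaceTime → ℝ) : SpaceTime → ℝ :=
  fun p => w p ⬝ᵥ grad f p

/-! ### The flow and the fields -/

/-- The part `{(t, g_t(x)) : t ∈ ℝ, x ∈ D}` of space-time occupied by the fluid. -/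
def fluidDomain (D : Set R3) (g : ℝ → R3 → R3) : Set SpaceTime :=
  {p | p.2 ∈ g p.1 '' D}

/-- `g` is a smooth curve of volume preserving embeddings of the open set `D`, starting at the
identity, and `v` is its (smooth) Eulerian velocity field. -/
structure IsIncompressibleFlow (D : Set R3) (g : ℝ → R3 → R3) (v : SpaceTime → R3) : Prop where
  isOpen : IsOpen D
  smooth : ContDiffOn ℝ ∞ (fun p : SpaceTime => g p.1 p.2) (univ ×ˢ D)
  initial : ∀ x ∈ D, g 0 x = x
  injOn : ∀ t, InjOn (g t) D
  volumePreserving : ∀ t, ∀ x ∈ D, (fderiv ℝ (g t) x).det = 1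
  smooth_velocity : ContDiffOn ℝ ∞ v (fluidDomain D g)
  velocity : ∀ x ∈ D, ∀ t, HasDerivAt (fun s => g s x) (v (t, g t x)) t

/-- `f` is a Lagrangian invariant, that is, a conserved function of the velocity field:
it is smooth and `∂f/∂t + v · ∇f = 0` on `U`. -/
def IsLagrangianInvariant (U : Set SpaceTime) (v : SpaceTime → R3) (f : SpaceTime → ℝ) : Prop :=
  ContDiffOn ℝ ∞ f U ∧ ∀ p ∈ U, dt f p + along v f p = 0

/-- The fields carried by the flow: a divergence-free frozen-in field `B`, and conserved functions
`φ` and `h`, with the Liouville density `- B · ∇φ` normalized to one. -/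
structure IsFrozenSystem (U : Set SpaceTime) (v B : SpaceTime → R3) (φ h : SpaceTime → ℝ) :
    Prop where
  smooth_B : ContDiffOn ℝ ∞ B U
  div_B : ∀ p ∈ U, divergence B p = 0
  frozen : ∀ p ∈ U, dt B p - curl (cross v B) p = 0
  conserved_φ : IsLagrangianInvariant U v φ
  conserved_h : IsLagrangianInvariant U v h
  density : ∀ p ∈ U, -(B p ⬝ᵥ grad φ p) = 1

/-- The hierarchy of symmetries in characteristic form: `û₀ = B`, `û₁ = ∇φ × ∇h`,
`û₂ = ∇ × (û₁ × û₀)`, and `û_k = ∇ × (û₁ × û_{k-1})` for `k ≥ 3`. -/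
def symmetryField (B : SpaceTime → R3) (φ h : SpaceTime → ℝ) : ℕ → SpaceTime → R3
  | 0 => B
  | 1 => cross (grad φ) (grad h)
  | 2 => curl (cross (cross (grad φ) (grad h)) B)
  | k + 3 => curl (cross (cross (grad φ) (grad h)) (symmetryField B φ h (k + 2)))

/-- `A k`, `ψ k` are smooth vector and scalar potentials for the hierarchy (any choice of gauge):
`∇ × A_k = û_k`, `∂A₀/∂t - v × (∇ × A₀) = ∇(φ + ψ₀)`, and `∂A_k/∂t + û_k × v = ∇ψ_k`
for `k ≥ 1`. -/
structure ArePotentials (U : Set SpaceTime) (v B : SpaceTime → R3) (φ h : SpaceTime → ℝ)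
    (A : ℕ → SpaceTime → R3) (ψ : ℕ → SpaceTime → ℝ) : Prop where
  smooth_A : ∀ k, ContDiffOn ℝ ∞ (A k) U
  smooth_ψ : ∀ k, ContDiffOn ℝ ∞ (ψ k) U
  curl_A : ∀ k, ∀ p ∈ U, curl (A k) p = symmetryField B φ h k p
  scalar_zero : ∀ p ∈ U,
    dt (A 0) p - cross v (curl (A 0)) p = grad (fun q => φ q + ψ 0 q) p
  scalar_pos : ∀ k, 1 ≤ k → ∀ p ∈ U,
    dt (A k) p + cross (symmetryField B φ h k) v p = grad (ψ k) p

/-! ### Differential forms on `ℝ × ℝ³` -/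

/-- A one-form seen as an alternating form of degree one. -/
def toForm (α : SpaceTime → SpaceTime →L[ℝ] ℝ) : SpaceTime → SpaceTime [⋀^Fin 1]→L[ℝ] ℝ :=
  fun p => ContinuousAlternatingMap.ofSubsingleton ℝ SpaceTime ℝ (0 : Fin 1) (α p)

/-- The wedge product `α ∧ β` of a covector and an `n`-covector:
`(α ∧ β)(a₀, …, aₙ) = ∑ᵢ (-1)ⁱ α(aᵢ) β(a₀, …, âᵢ, …, aₙ)`. -/
def wedge {n : ℕ} (α : SpaceTime →L[ℝ] ℝ) (β : SpaceTime [⋀^Fin n]→L[ℝ] ℝ) :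
    SpaceTime [⋀^Fin (n + 1)]→L[ℝ] ℝ :=
  ContinuousAlternatingMap.alternatizeUncurryFin (ContinuousLinearMap.smulRight α β)

/-- The wedge product of two covectors. -/
def wedge₁ (α β : SpaceTime →L[ℝ] ℝ) : SpaceTime [⋀^Fin 2]→L[ℝ] ℝ :=
  wedge α (ContinuousAlternatingMap.ofSubsingleton ℝ SpaceTime ℝ (0 : Fin 1) β)

/-- The coordinate covector `dt`. -/
def dT : SpaceTime →L[ℝ] ℝ := ContinuousLinearMap.fst ℝ ℝ R3

/-- The coordinate covectors `dx_i`. -/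
def dX (i : Fin 3) : SpaceTime →L[ℝ] ℝ :=
  (ContinuousLinearMap.proj i : R3 →L[ℝ] ℝ).comp (ContinuousLinearMap.snd ℝ ℝ R3)

/-- `w · dx`. -/
def dotDx (w : R3) : SpaceTime →L[ℝ] ℝ := ∑ i, w i • dX i

/-- `w · dx ∧ dx`, that is `w₀ dx₁ ∧ dx₂ + w₁ dx₂ ∧ dx₀ + w₂ dx₀ ∧ dx₁`. -/
def dotDxDx (w : R3) : SpaceTime [⋀^Fin 2]→L[ℝ] ℝ :=
  w 0 • wedge₁ (dX 1) (dX 2) + w 1 • wedge₁ (dX 2) (dX 0) + w 2 • wedge₁ (dX 0) (dX 1)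

/-- The symplectic two-form `Ω = -(∇φ + v × B) · dx ∧ dt + B · (dx ∧ dx)`. -/
def symplecticForm (v B : SpaceTime → R3) (φ : SpaceTime → ℝ) :
    SpaceTime → SpaceTime [⋀^Fin 2]→L[ℝ] ℝ :=
  fun p => -wedge₁ (dotDx (grad φ p + cross v B p)) dT + dotDxDx (B p)

/-- The invariant two-forms: `Θ₀ = Ω` and
`Θ_k = - û_k · dx ∧ dx - (û_k × v) · dx ∧ dt` for `k ≥ 1`. -/
def Theta (v B : SpaceTime → R3) (φ h : SpaceTime → ℝ) :
    ℕ → SpaceTime → SpaceTime [⋀^Fin 2]→L[ℝ] ℝ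
  | 0 => symplecticForm v B φ
  | k + 1 => fun p => -dotDxDx (symmetryField B φ h (k + 1) p)
      - wedge₁ (dotDx (cross (symmetryField B φ h (k + 1)) v p)) dT

/-- The one-forms: `θ₀ = -(ψ₀ dt + A₀ · dx)` and `θ_k = ψ_k dt + A_k · dx` for `k ≥ 1`. -/
def theta (A : ℕ → SpaceTime → R3) (ψ : ℕ → SpaceTime → ℝ) :
    ℕ → SpaceTime → SpaceTime →L[ℝ] ℝ
  | 0 => fun p => -(ψ 0 p • dT + dotDx (A 0 p))
  | k + 1 => fun p => ψ (k + 1) p • dT + dotDx (A (k + 1) p)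

/-- The two-forms `dθ_k`. -/
def dTheta (A : ℕ → SpaceTime → R3) (ψ : ℕ → SpaceTime → ℝ) (k : ℕ) :
    SpaceTime → SpaceTime [⋀^Fin 2]→L[ℝ] ℝ :=
  extDeriv (toForm (theta A ψ k))

/-- The functions `χ_k` with `L_{∂ₜ+v} θ_k = dχ_k`: `χ₀ = -(ψ₀ + φ + v · A₀)` (the term `φ` comes
from `i(∂ₜ+v)Ω = dφ`), and `χ_k = ψ_k + v · A_k` for `k ≥ 1`. -/
def chi (v : SpaceTime → R3) (φ : SpaceTime → ℝ) (A : ℕ → SpaceTime → R3)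
    (ψ : ℕ → SpaceTime → ℝ) : ℕ → SpaceTime → ℝ
  | 0 => fun p => -(ψ 0 p + φ p + v p ⬝ᵥ A 0 p)
  | k + 1 => fun p => ψ (k + 1) p + v p ⬝ᵥ A (k + 1) p

/-- The three-form `θ_k ∧ dθ_l`. -/
def helicityForm (A : ℕ → SpaceTime → R3) (ψ : ℕ → SpaceTime → ℝ) (k l : ℕ) :
    SpaceTime → SpaceTime [⋀^Fin 3]→L[ℝ] ℝ :=
  fun p => wedge (theta A ψ k p) (dTheta A ψ l p)

/-- The generalized helicity density: the coefficient of `dx₀ ∧ dx₁ ∧ dx₂` in `θ_k ∧ dθ_l`. -/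
def helicityDensity (A : ℕ → SpaceTime → R3) (ψ : ℕ → SpaceTime → ℝ) (k l : ℕ) :
    SpaceTime → ℝ :=
  fun p => helicityForm A ψ k l p spaceBasis

/-! ### Regions in `ℝ × ℝ³`: smooth singular chains, their boundaries, and integration -/

/-- A map of the unit `n`-cube into space-time. -/
abbrev SingularCube (n : ℕ) : Type := (Fin n → unitInterval) → SpaceTime

/-- Integral chains of `n`-cubes. -/
abbrev Chain (n : ℕ) : Type := SingularCube n →₀ ℤ

/-- A cube as a function on `ℝⁿ`, extended by clamping the coordinates to `[0, 1]`. -/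
def cubeExt {n : ℕ} (c : SingularCube n) : (Fin n → ℝ) → SpaceTime :=
  fun y => c fun i => projIcc 0 1 zero_le_one (y i)

/-- Smoothness of a cube, up to its boundary. -/
def IsSmoothCube {n : ℕ} (c : SingularCube n) : Prop :=
  ContDiffOn ℝ ∞ (cubeExt c) (Icc 0 1)

/-- The `i`-th tangent vector of a cube. -/
def cubeTangent {n : ℕ} (c : SingularCube n) (y : Fin n → ℝ) (i : Fin n) : SpaceTime :=
  fderivWithin ℝ (cubeExt c) (Icc 0 1) y (Pi.single i 1)

/-- The integral of an `n`-form over a cube. -/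
def cubeIntegral {n : ℕ} (c : SingularCube n) (β : SpaceTime → SpaceTime [⋀^Fin n]→L[ℝ] ℝ) : ℝ :=
  ∫ y in Icc (0 : Fin n → ℝ) 1, β (cubeExt c y) (cubeTangent c y)

/-- The integral of an `n`-form over a chain. -/
def chainIntegral {n : ℕ} (S : Chain n) (β : SpaceTime → SpaceTime [⋀^Fin n]→L[ℝ] ℝ) : ℝ :=
  S.sum fun c m => (m : ℝ) * cubeIntegral c β

/-- The face of a cube on which the `i`-th coordinate is `e`. -/
def face {n : ℕ} (c : SingularCube (n + 1)) (i : Fin (n + 1)) (e : unitInterval) : SingularCube n :=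
  fun y => c (Fin.insertNth i e y)

/-- The oriented boundary of a cube. -/
def cubeBoundary {n : ℕ} (c : SingularCube (n + 1)) : Chain n :=
  ∑ i : Fin (n + 1), (-1 : ℤ) ^ (i : ℕ) •
    (Finsupp.single (face c i 1) (1 : ℤ) - Finsupp.single (face c i 0) (1 : ℤ))

/-- The oriented boundary of a chain. -/
def boundary {n : ℕ} (S : Chain (n + 1)) : Chain n :=
  S.sum fun c m => m • cubeBoundary c

/-- A region in Lagrangian labels: a chain of smooth cubes in `ℝ × D`. -/
def IsLabelRegion {n : ℕ} (D : Set R3) (S : Chain n) : Prop :=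
  ∀ c ∈ S.support, IsSmoothCube c ∧ ∀ y, (c y).2 ∈ D

/-- The region at time `t` advected by the graph of the flow: the label point `(τ, x)` is carried
to `(τ + t, g_{τ+t}(x))`, along the trajectories of `∂ₜ + v`. -/
def advect {n : ℕ} (g : ℝ → R3 → R3) (t : ℝ) (S : Chain n) : Chain n :=
  Finsupp.mapDomain
    (fun (c : SingularCube n) (y : Fin n → unitInterval) => ((c y).1 + t, g ((c y).1 + t) (c y).2)) S

/-- The region lies in a single time slice `{τ} × ℝ³`. -/
def InTimeSlice {n : ℕ} (S : Chain n) : Prop :=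
  ∃ τ : ℝ, ∀ c ∈ S.support, ∀ y, (c y).1 = τ

/-- The spatial field `w` is tangent to the projection onto `ℝ³` of a surface in space-time:
wherever the surface is immersed, `w` lies in the projection of its tangent plane. -/
def TangentToProjection (w : SpaceTime → R3) (b : Chain 2) : Prop :=
  ∀ c ∈ b.support, ∀ y : Fin 2 → unitInterval,
    LinearIndependent ℝ (cubeTangent c fun i => (y i : ℝ)) →
      w (c y) ∈ Submodule.span ℝ (range fun j => (cubeTangent c (fun i => (y i : ℝ)) j).2)

/-! ### The Poisson algebra on `ℝ³` -/

/-- The bracket `{f, g}_φ = ∇φ · (∇f × ∇g)`. -/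
def bracket (φ f g : SpaceTime → ℝ) : SpaceTime → ℝ :=
  fun p => grad φ p ⬝ᵥ (grad f p ⨯₃ grad g p)

/-- `S` is a Poisson algebra of smooth functions on `U` with bracket `{ , }_φ`: it contains the
constants, is closed under sums, products and brackets, depends only on values on `U`, and
the bracket is skew-symmetric and satisfies the Leibniz rule and the Jacobi identity. -/
structure IsPoissonAlgebra (U : Set SpaceTime) (φ : SpaceTime → ℝ)
    (S : Set (SpaceTime → ℝ)) : Prop where
  smooth : ∀ f ∈ S, ContDiffOn ℝ ∞ f U
  congr : ∀ f ∈ S, ∀ f', EqOn f f' U → f' ∈ S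
  const : ∀ c : ℝ, (fun _ => c) ∈ S
  add : ∀ f ∈ S, ∀ f' ∈ S, (fun p => f p + f' p) ∈ S
  mul : ∀ f ∈ S, ∀ f' ∈ S, (fun p => f p * f' p) ∈ S
  bracket_mem : ∀ f ∈ S, ∀ f' ∈ S, bracket φ f f' ∈ S
  skew : ∀ f ∈ S, ∀ f' ∈ S, ∀ p ∈ U, bracket φ f f' p = -bracket φ f' f p
  bracket_add : ∀ f ∈ S, ∀ f₁ ∈ S, ∀ f₂ ∈ S, ∀ p ∈ U,
    bracket φ f (fun q => f₁ q + f₂ q) p = bracket φ f f₁ p + bracket φ f f₂ p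
  leibniz : ∀ f ∈ S, ∀ f₁ ∈ S, ∀ f₂ ∈ S, ∀ p ∈ U,
    bracket φ f (fun q => f₁ q * f₂ q) p = bracket φ f f₁ p * f₂ p + f₁ p * bracket φ f f₂ p
  jacobi : ∀ f₁ ∈ S, ∀ f₂ ∈ S, ∀ f₃ ∈ S, ∀ p ∈ U,
    bracket φ f₁ (bracket φ f₂ f₃) p + bracket φ f₂ (bracket φ f₃ f₁) p
      + bracket φ f₃ (bracket φ f₁ f₂) p = 0

/-- The generalized potential vorticities, `potVort j = h_{j+1}`: `h₁ = h`, `h₂ = û₀(h)`, and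
`h_k = - û₁(h_{k-1}) = (-1)^k û₁^{k-2}(û₀(h))` for `k ≥ 3`. -/
def potVort (B : SpaceTime → R3) (φ h : SpaceTime → ℝ) : ℕ → SpaceTime → ℝ
  | 0 => h
  | 1 => along B h
  | j + 2 => fun p => -along (cross (grad φ) (grad h)) (potVort B φ h (j + 1)) p

/-- The explicit vector potentials, `explicitPotential j = A_{j+1}`: `A₁ = φ ∇h`,
`A₂ = û₁ × û₀`, and `A_k = û₁ × û_{k-1}` for `k ≥ 3`. -/
def explicitPotential (B : SpaceTime → R3) (φ h : SpaceTime → ℝ) : ℕ → SpaceTime → R3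
  | 0 => fun p => φ p • grad h p
  | 1 => cross (symmetryField B φ h 1) B
  | j + 2 => cross (symmetryField B φ h 1) (symmetryField B φ h (j + 2))

end VorticityConservation

end

/-!
# Conservation laws of the frozen-in hierarchy

Let `G(t, x) = (t, g_t(x))` be the flow map from Lagrangian labels to the fluid domain. It carries
`∂ₜ` to `∂ₜ + v`, and advection of a region is translation of its labels in time. All
conservation laws of integrals come from Cartan's formula `L_{∂ₜ+v} θ_k = dχ_k`. In labels the
transport field is constant, so the formula says that the time derivative of `G^*θ_k` is
`d(χ_k ∘ G)` (`fderiv_labelTheta_timeDir`); it rests on the contraction of `dθ_k = -Θ_k` with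
`∂ₜ + v`, computed in `ArePotentials.dTheta_transport`. Exterior and time derivatives commute, so
`G^*dθ_k` is constant in time (`labelDTheta_add_timeDir`). Hence `∫ Θ_k` is conserved, and the
helicity changes at the rate `∫ dχ_k ∧ dθ_l = ∫ d(χ_k dθ_l)`. Stokes' theorem for smooth chains
(`chainIntegral_extDeriv`, from the divergence theorem on a box) turns this into boundary
integrals; applied to closed forms it gives `∮ dχ_k = 0` and the integration by parts
`∮ χ_k dθ_l = -∮ dχ_k ∧ θ_l`. On a boundary to whose projection `û_l` is tangent, `dθ_l` restricts
to zero (`dTheta_eq_zero_of_tangent`).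

The pointwise laws are statements about fields that commute with `∂ₜ + v`. A divergence-free field
`w` with `∂w/∂t = ∇ × (v × w)` is such a field (`IsFrozenIn`), and differentiation along it
preserves Lagrangian invariants. The curl of the potential equation shows that every `û_k` is
frozen in. Incompressibility, needed here, already follows from `-B · ∇φ = 1`
(`IsFrozenSystem.divergence_eq_zero`). The helicity density is `± A_k · û_l`, whose material
derivative is `± û_l · ∇χ_k`. The bracket `{f, g}_φ` is the derivative of `g` along the frozen-in
field `∇φ × ∇f`, so the invariants are closed under it. Finally, `∇ × (û₁ × Y)` acts on functions
as minus the commutator of `û₁` and `Y`, and `û₁ = {h, ·}_φ` annihilates `φ` and `h`; therefore all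
`û_l(φ)` and `û_l(h)` are iterated brackets of `h` with `û₀(φ) = -1` and `û₀(h) = h₂`
(`ArePotentials.along_symmetryField_mem`), and the densities of the explicit potentials are
polynomials in them.
-/

noncomputable section

namespace VorticityConservation

/-! ### Pointwise vector calculus -/

section Calculus

variable {V : Type*} [NormedAddCommGroup V] [NormedSpace ℝ V]
  {p : SpaceTime} {f f' : SpaceTime → ℝ} {F G : SpaceTime → R3}

lemma _root_.ContDiffAt.differentiableAt_infty {F : SpaceTime → V} (hF : ContDiffAt ℝ ∞ F p) :
    DifferentiableAt ℝ F p :=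
  hF.differentiableAt (by simp)

lemma contDiffAt_fderiv_apply {F : SpaceTime → V} (hF : ContDiffAt ℝ ∞ F p) (a : SpaceTime) :
    ContDiffAt ℝ ∞ (fun q => fderiv ℝ F q a) p :=
  (hF.fderiv_right (m := ∞) (by simp)).clm_apply contDiffAt_const

lemma fderiv_fderiv_apply {F : SpaceTime → V} (hF : ContDiffAt ℝ ∞ F p) (a b : SpaceTime) :
    fderiv ℝ (fun q => fderiv ℝ F q a) p b = fderiv ℝ (fderiv ℝ F) p b a := by
  have h : DifferentiableAt ℝ (fderiv ℝ F) p :=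
    (hF.fderiv_right (m := ∞) (by simp)).differentiableAt (by simp)
  rw [fderiv_clm_apply h (differentiableAt_const a)]
  simp

lemma fderiv_fderiv_symm {F : SpaceTime → V} (hF : ContDiffAt ℝ ∞ F p) (a b : SpaceTime) :
    fderiv ℝ (fderiv ℝ F) p a b = fderiv ℝ (fderiv ℝ F) p b a :=
  (hF.isSymmSndFDerivAt (by simpa using ENat.LEInfty.out)).eq a b

lemma fderiv_component (hF : DifferentiableAt ℝ F p) (a : SpaceTime) (i : Fin 3) :
    fderiv ℝ (fun q => F q i) p a = fderiv ℝ F p a i := by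
  rw [fderiv_apply hF]; rfl

lemma contDiffAt_grad (hf : ContDiffAt ℝ ∞ f p) : ContDiffAt ℝ ∞ (grad f) p :=
  contDiffAt_pi.2 fun i => contDiffAt_fderiv_apply hf (spaceBasis i)

lemma contDiffAt_dot (hF : ContDiffAt ℝ ∞ F p) (hG : ContDiffAt ℝ ∞ G p) :
    ContDiffAt ℝ ∞ (fun q => F q ⬝ᵥ G q) p :=
  ContDiffAt.sum fun i _ => (contDiffAt_pi.1 hF i).mul (contDiffAt_pi.1 hG i)

lemma contDiffAt_cross (hF : ContDiffAt ℝ ∞ F p) (hG : ContDiffAt ℝ ∞ G p) :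
    ContDiffAt ℝ ∞ (cross F G) p := by
  have hF := contDiffAt_pi.1 hF
  have hG := contDiffAt_pi.1 hG
  refine contDiffAt_pi.2 fun i => ?_
  fin_cases i <;> simp only [cross, cross_apply] <;>
  exact ((hF _).mul (hG _)).sub ((hF _).mul (hG _))

lemma contDiffAt_partialD (hF : ContDiffAt ℝ ∞ F p) (i j : Fin 3) :
    ContDiffAt ℝ ∞ (partialD F i j) p :=
  contDiffAt_pi.1 (contDiffAt_fderiv_apply hF (spaceBasis i)) j

lemma contDiffAt_curl (hF : ContDiffAt ℝ ∞ F p) : ContDiffAt ℝ ∞ (curl F) p := by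
  refine contDiffAt_pi.2 fun i => ?_
  fin_cases i <;>
  exact (contDiffAt_partialD hF _ _).sub (contDiffAt_partialD hF _ _)

lemma contDiffAt_along (hF : ContDiffAt ℝ ∞ F p) (hf : ContDiffAt ℝ ∞ f p) :
    ContDiffAt ℝ ∞ (along F f) p :=
  contDiffAt_dot hF (contDiffAt_grad hf)

lemma fderiv_dot (hF : ContDiffAt ℝ ∞ F p) (hG : ContDiffAt ℝ ∞ G p) (a : SpaceTime) :
    fderiv ℝ (fun q => F q ⬝ᵥ G q) p a
      = fderiv ℝ F p a ⬝ᵥ G p + F p ⬝ᵥ fderiv ℝ G p a := by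
  have hF' := fun i => (contDiffAt_pi.1 hF i).differentiableAt_infty
  have hG' := fun i => (contDiffAt_pi.1 hG i).differentiableAt_infty
  simp only [dotProduct]
  rw [fderiv_fun_sum fun i _ => (hF' i).fun_mul (hG' i), ← Finset.sum_add_distrib]
  simp only [_root_.sum_apply]
  refine Finset.sum_congr rfl fun i _ => ?_
  rw [fderiv_fun_mul (hF' i) (hG' i)]
  simp only [_root_.add_apply, _root_.smul_apply, smul_eq_mul,
    fderiv_component hF.differentiableAt_infty, fderiv_component hG.differentiableAt_infty]
  ring

lemma fderiv_cross (hF : ContDiffAt ℝ ∞ F p) (hG : ContDiffAt ℝ ∞ G p) (a : SpaceTime) :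
    fderiv ℝ (cross F G) p a = fderiv ℝ F p a ⨯₃ G p + F p ⨯₃ fderiv ℝ G p a := by
  have hF' := fun i => (contDiffAt_pi.1 hF i).differentiableAt_infty
  have hG' := fun i => (contDiffAt_pi.1 hG i).differentiableAt_infty
  have key : ∀ i j k l, fderiv ℝ (fun q => F q i * G q j - F q k * G q l) p a
      = fderiv ℝ F p a i * G p j + F p i * fderiv ℝ G p a j
        - (fderiv ℝ F p a k * G p l + F p k * fderiv ℝ G p a l) := by
    intro i j k l
    rw [fderiv_fun_sub ((hF' i).fun_mul (hG' j)) ((hF' k).fun_mul (hG' l)),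
      fderiv_fun_mul (hF' i) (hG' j), fderiv_fun_mul (hF' k) (hG' l)]
    simp only [_root_.add_apply, _root_.smul_apply, smul_eq_mul,
      _root_.sub_apply,
      fderiv_component hF.differentiableAt_infty, fderiv_component hG.differentiableAt_infty]
    ring
  ext i
  rw [← fderiv_component (contDiffAt_cross hF hG).differentiableAt_infty]
  fin_cases i <;> simp [cross, cross_apply, key] <;> ring

lemma dot_grad (w : R3) : w ⬝ᵥ grad f p = fderiv ℝ f p (0, w) := by
  have h : ((0, w) : SpaceTime) = ∑ i, w i • spaceBasis i := by
    ext i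
    · simp [spaceBasis, Prod.fst_sum]
    · simp [spaceBasis, Prod.snd_sum, Finset.sum_apply, Pi.single_apply]
  rw [h, map_sum]
  simp [dotProduct, grad]

lemma along_apply (w : SpaceTime → R3) : along w f p = fderiv ℝ f p (0, w p) :=
  dot_grad _

/-- Transport along the flow is differentiation along the space-time field `(1, v)`. -/
lemma dt_add_along (v : SpaceTime → R3) : dt f p + along v f p = fderiv ℝ f p (1, v p) := by
  rw [along_apply, dt, ← map_add]; simp

lemma fderiv_space (w : R3) (j : Fin 3) :
    fderiv ℝ F p (0, w) j = ∑ i, w i * partialD F i j p := by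
  have h : ((0, w) : SpaceTime) = ∑ i, w i • spaceBasis i := by
    ext i
    · simp [spaceBasis, Prod.fst_sum]
    · simp [spaceBasis, Prod.snd_sum, Finset.sum_apply, Pi.single_apply]
  rw [h, map_sum]
  simp [partialD, Finset.sum_apply]

lemma fderiv_grad (hf : ContDiffAt ℝ ∞ f p) (a : SpaceTime) (i : Fin 3) :
    fderiv ℝ (grad f) p a i = fderiv ℝ (fderiv ℝ f) p a (spaceBasis i) := by
  rw [← fderiv_component (contDiffAt_grad hf).differentiableAt_infty]
  exact fderiv_fderiv_apply hf _ _

lemma partialD_grad (hf : ContDiffAt ℝ ∞ f p) (i j : Fin 3) :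
    partialD (grad f) i j p = fderiv ℝ (fderiv ℝ f) p (spaceBasis i) (spaceBasis j) :=
  fderiv_grad hf _ _

lemma partialD_grad_symm (hf : ContDiffAt ℝ ∞ f p) (i j : Fin 3) :
    partialD (grad f) i j p = partialD (grad f) j i p := by
  rw [partialD_grad hf, partialD_grad hf, fderiv_fderiv_symm hf]

lemma fderiv_along {w : SpaceTime → R3} (hw : ContDiffAt ℝ ∞ w p) (hf : ContDiffAt ℝ ∞ f p)
    (a : SpaceTime) :
    fderiv ℝ (along w f) p a
      = fderiv ℝ (fderiv ℝ f) p a (0, w p) + fderiv ℝ f p (0, fderiv ℝ w p a) := by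
  have h : along w f = fun q => fderiv ℝ f q (0, w q) := funext fun q => along_apply w
  have hw' : HasFDerivAt (fun q => ((0, w q) : SpaceTime))
      ((ContinuousLinearMap.inr ℝ ℝ R3).comp (fderiv ℝ w p)) p :=
    (ContinuousLinearMap.inr ℝ ℝ R3).hasFDerivAt.comp p hw.differentiableAt_infty.hasFDerivAt
  have hf' : DifferentiableAt ℝ (fderiv ℝ f) p :=
    (hf.fderiv_right (m := ∞) (by simp)).differentiableAt (by simp)
  rw [h, (hf'.hasFDerivAt.clm_apply hw').fderiv]
  simp [add_comm]

lemma fderiv_curl (hF : ContDiffAt ℝ ∞ F p) (a : SpaceTime) :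
    fderiv ℝ (curl F) p a
      = ![fderiv ℝ (fderiv ℝ F) p a (spaceBasis 1) 2 - fderiv ℝ (fderiv ℝ F) p a (spaceBasis 2) 1,
          fderiv ℝ (fderiv ℝ F) p a (spaceBasis 2) 0 - fderiv ℝ (fderiv ℝ F) p a (spaceBasis 0) 2,
          fderiv ℝ (fderiv ℝ F) p a (spaceBasis 0) 1
            - fderiv ℝ (fderiv ℝ F) p a (spaceBasis 1) 0] := by
  have h1 : ∀ i j, DifferentiableAt ℝ (partialD F i j) p := fun i j =>
    (contDiffAt_partialD hF i j).differentiableAt_infty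
  have h2 : ∀ i j, fderiv ℝ (partialD F i j) p a = fderiv ℝ (fderiv ℝ F) p a (spaceBasis i) j := by
    intro i j
    rw [← fderiv_fderiv_apply hF,
      ← fderiv_component (contDiffAt_fderiv_apply hF _).differentiableAt_infty]
    rfl
  ext i
  rw [← fderiv_component (contDiffAt_curl hF).differentiableAt_infty]
  fin_cases i
  · change fderiv ℝ (fun q => partialD F 1 2 q - partialD F 2 1 q) p a = _
    rw [fderiv_fun_sub (h1 _ _) (h1 _ _), _root_.sub_apply, h2, h2]; rfl
  · change fderiv ℝ (fun q => partialD F 2 0 q - partialD F 0 2 q) p a = _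
    rw [fderiv_fun_sub (h1 _ _) (h1 _ _), _root_.sub_apply, h2, h2]; rfl
  · change fderiv ℝ (fun q => partialD F 0 1 q - partialD F 1 0 q) p a = _
    rw [fderiv_fun_sub (h1 _ _) (h1 _ _), _root_.sub_apply, h2, h2]; rfl

lemma divergence_curl (hF : ContDiffAt ℝ ∞ F p) : divergence (curl F) p = 0 := by
  simp only [divergence, partialD, Fin.sum_univ_three, fderiv_curl hF]
  rw [fderiv_fderiv_symm hF (spaceBasis 0) (spaceBasis 1),
    fderiv_fderiv_symm hF (spaceBasis 0) (spaceBasis 2),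
    fderiv_fderiv_symm hF (spaceBasis 1) (spaceBasis 2)]
  simp

lemma curl_grad (hf : ContDiffAt ℝ ∞ f p) : curl (grad f) p = 0 := by
  ext i
  fin_cases i <;> simp [curl, partialD_grad_symm hf 1 2, partialD_grad_symm hf 0 2,
    partialD_grad_symm hf 0 1]

lemma partialD_dt (hF : ContDiffAt ℝ ∞ F p) (i j : Fin 3) :
    partialD (dt F) i j p = fderiv ℝ (fderiv ℝ F) p (1, 0) (spaceBasis i) j := by
  rw [fderiv_fderiv_symm hF, ← fderiv_fderiv_apply hF]; rfl

lemma curl_dt (hF : ContDiffAt ℝ ∞ F p) : curl (dt F) p = dt (curl F) p := by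
  rw [dt, fderiv_curl hF]
  simp only [curl, partialD_dt hF]

lemma partialD_add (hF : ContDiffAt ℝ ∞ F p) (hG : ContDiffAt ℝ ∞ G p) (i j : Fin 3) :
    partialD (fun q => F q + G q) i j p = partialD F i j p + partialD G i j p := by
  simp only [partialD]
  rw [fderiv_fun_add hF.differentiableAt_infty hG.differentiableAt_infty]; rfl

lemma curl_add (hF : ContDiffAt ℝ ∞ F p) (hG : ContDiffAt ℝ ∞ G p) :
    curl (fun q => F q + G q) p = curl F p + curl G p := by
  ext i
  fin_cases i <;> simp [curl, partialD_add hF hG] <;> ring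

lemma curl_congr (h : F =ᶠ[nhds p] G) : curl F p = curl G p := by
  simp only [curl, partialD, h.fderiv_eq]

/-- `∇ × (F × G) = F (∇ · G) - G (∇ · F) + (G · ∇) F - (F · ∇) G`. -/
lemma curl_cross (hF : ContDiffAt ℝ ∞ F p) (hG : ContDiffAt ℝ ∞ G p) :
    curl (cross F G) p = divergence G p • F p - divergence F p • G p
      + fderiv ℝ F p (0, G p) - fderiv ℝ G p (0, F p) := by
  ext i
  simp only [curl, partialD, fderiv_cross hF hG, Pi.add_apply, Pi.sub_apply, Pi.smul_apply,
    fderiv_space, divergence, Fin.sum_univ_three, cross_apply]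
  fin_cases i <;> simp <;> ring

end Calculus

/-! ### Frozen-in fields and Lagrangian invariants -/

section Frozen

variable {U : Set SpaceTime} {v w B : SpaceTime → R3} {φ h f f' : SpaceTime → ℝ} {p : SpaceTime}

/-- A field `w` is frozen into the flow of `v` if `∂w/∂t + (v · ∇)w - (w · ∇)v = 0`, that is, if
it commutes with `∂ₜ + v`. For divergence-free fields this is `∂w/∂t - ∇ × (v × w) = 0`. -/
def IsFrozenIn (U : Set SpaceTime) (v w : SpaceTime → R3) : Prop :=
  ContDiffOn ℝ ∞ w U ∧ ∀ p ∈ U, fderiv ℝ w p (1, v p) = fderiv ℝ v p (0, w p)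

lemma isLagrangianInvariant_iff :
    IsLagrangianInvariant U v f ↔ ContDiffOn ℝ ∞ f U ∧ ∀ p ∈ U, fderiv ℝ f p (1, v p) = 0 := by
  simp only [IsLagrangianInvariant, dt_add_along]

lemma contDiffOn_of_forall {V : Type*} [NormedAddCommGroup V] [NormedSpace ℝ V]
    {F : SpaceTime → V} (h : ∀ p ∈ U, ContDiffAt ℝ ∞ F p) :
    ContDiffOn ℝ ∞ F U := fun p hp => (h p hp).contDiffWithinAt

lemma fderiv_transport (hv : ContDiffAt ℝ ∞ v p) (hf : ContDiffAt ℝ ∞ f p) (a : SpaceTime) :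
    fderiv ℝ (fun q => fderiv ℝ f q (1, v q)) p a
      = fderiv ℝ (fderiv ℝ f) p a (1, v p) + fderiv ℝ f p (0, fderiv ℝ v p a) := by
  have hw' : HasFDerivAt (fun q => ((1, v q) : SpaceTime))
      ((0 : SpaceTime →L[ℝ] ℝ).prod (fderiv ℝ v p)) p :=
    (hasFDerivAt_const (1 : ℝ) p).prodMk hv.differentiableAt_infty.hasFDerivAt
  have hf' : DifferentiableAt ℝ (fderiv ℝ f) p :=
    (hf.fderiv_right (m := ∞) (by simp)).differentiableAt (by simp)
  rw [(hf'.hasFDerivAt.clm_apply hw').fderiv]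
  simp [add_comm]

/-- Differentiating `∂f/∂t + v · ∇f = 0`: the differential of an invariant is transported. -/
lemma IsLagrangianInvariant.fderiv_fderiv (hU : IsOpen U) (hv : ContDiffOn ℝ ∞ v U)
    (hf : IsLagrangianInvariant U v f) (hp : p ∈ U) (a : SpaceTime) :
    fderiv ℝ (fderiv ℝ f) p (1, v p) a = -fderiv ℝ f p (0, fderiv ℝ v p a) := by
  rw [isLagrangianInvariant_iff] at hf
  have hfp := hf.1.contDiffAt (hU.mem_nhds hp)
  have h0 : (fun q => fderiv ℝ f q (1, v q)) =ᶠ[nhds p] fun _ => 0 :=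
    Filter.eventually_of_mem (hU.mem_nhds hp) hf.2
  have h1 := fderiv_transport (hv.contDiffAt (hU.mem_nhds hp)) hfp a
  rw [h0.fderiv_eq, fderiv_fderiv_symm hfp] at h1
  simp only [fderiv_fun_const, Pi.zero_apply, zero_apply] at h1
  linarith

lemma IsFrozenIn.along (hU : IsOpen U) (hv : ContDiffOn ℝ ∞ v U) (hw : IsFrozenIn U v w)
    (hf : IsLagrangianInvariant U v f) : IsLagrangianInvariant U v (along w f) := by
  have hw' := fun p hp => hw.1.contDiffAt (hU.mem_nhds (x := p) hp)
  have hf' := fun p hp => hf.1.contDiffAt (hU.mem_nhds (x := p) hp)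
  refine isLagrangianInvariant_iff.2
    ⟨contDiffOn_of_forall fun p hp => contDiffAt_along (hw' p hp) (hf' p hp), fun p hp => ?_⟩
  rw [fderiv_along (hw' p hp) (hf' p hp), hf.fderiv_fderiv hU hv hp, hw.2 p hp]
  simp

lemma IsFrozenIn.of_curl (hU : IsOpen U) (hv : ContDiffOn ℝ ∞ v U)
    (hdiv : ∀ p ∈ U, divergence v p = 0) (hw : ContDiffOn ℝ ∞ w U)
    (hdivw : ∀ p ∈ U, divergence w p = 0) (h : ∀ p ∈ U, dt w p - curl (cross v w) p = 0) :
    IsFrozenIn U v w := by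
  refine ⟨hw, fun p hp => ?_⟩
  have h1 := h p hp
  rw [curl_cross (hv.contDiffAt (hU.mem_nhds hp)) (hw.contDiffAt (hU.mem_nhds hp)), hdiv p hp,
    hdivw p hp] at h1
  have h2 : ((1, v p) : SpaceTime) = (1, 0) + (0, v p) := by simp
  rw [h2, map_add]
  have h3 : dt w p = fderiv ℝ w p (1, 0) := rfl
  rw [← h3, sub_eq_zero.1 h1]
  simp

/-- Incompressibility is forced by the Liouville normalization: `∂ₜ + v` maps `B · ∇φ` to
`-(∇ · v) B · ∇φ`, and `B · ∇φ = -1` is constant. -/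
lemma IsFrozenSystem.divergence_eq_zero (hU : IsOpen U) (hv : ContDiffOn ℝ ∞ v U)
    (hs : IsFrozenSystem U v B φ h) (hp : p ∈ U) : divergence v p = 0 := by
  have hvp := hv.contDiffAt (hU.mem_nhds hp)
  have hBp := hs.smooth_B.contDiffAt (hU.mem_nhds hp)
  have hφp := hs.conserved_φ.1.contDiffAt (hU.mem_nhds hp)
  have h0 : ∀ q ∈ U, VorticityConservation.along B φ q = -1 := fun q hq => by
    have := hs.density q hq
    simp only [VorticityConservation.along]
    linarith
  have h1 : VorticityConservation.along B φ =ᶠ[nhds p] fun _ => -1 :=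
    Filter.eventually_of_mem (hU.mem_nhds hp) h0
  have h2 := fderiv_along hBp hφp (1, v p)
  rw [h1.fderiv_eq, hs.conserved_φ.fderiv_fderiv hU hv hp] at h2
  have h3 := hs.frozen p hp
  rw [curl_cross hvp hBp, hs.div_B p hp] at h3
  have h4 : ((1, v p) : SpaceTime) = (1, 0) + (0, v p) := by simp
  have h5 : fderiv ℝ B p (1, v p) = fderiv ℝ v p (0, B p) - divergence v p • B p := by
    rw [h4, map_add]
    have h6 : dt B p = fderiv ℝ B p (1, 0) := rfl
    rw [← h6, sub_eq_zero.1 h3]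
    simp only [zero_smul]
    abel
  have h7 : ((0, fderiv ℝ v p (0, B p) - divergence v p • B p) : SpaceTime)
      = (0, fderiv ℝ v p (0, B p)) - divergence v p • (0, B p) := by simp
  have h8 := h0 p hp
  rw [along_apply] at h8
  rw [h5, h7, map_sub, map_smul, h8] at h2
  simpa using h2.symm

lemma IsFrozenSystem.isFrozenIn (hU : IsOpen U) (hv : ContDiffOn ℝ ∞ v U)
    (hs : IsFrozenSystem U v B φ h) : IsFrozenIn U v B :=
  .of_curl hU hv (fun _ hp => hs.divergence_eq_zero hU hv hp) hs.smooth_B hs.div_B hs.frozen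

lemma IsFrozenIn.cross_grad (hU : IsOpen U) (hv : ContDiffOn ℝ ∞ v U)
    (hdiv : ∀ p ∈ U, divergence v p = 0) (hf : IsLagrangianInvariant U v f)
    (hf' : IsLagrangianInvariant U v f') : IsFrozenIn U v (cross (grad f) (grad f')) := by
  have h1 := fun p hp => contDiffAt_grad (hf.1.contDiffAt (hU.mem_nhds (x := p) hp))
  have h2 := fun p hp => contDiffAt_grad (hf'.1.contDiffAt (hU.mem_nhds (x := p) hp))
  refine ⟨contDiffOn_of_forall fun p hp => contDiffAt_cross (h1 p hp) (h2 p hp), fun p hp => ?_⟩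
  have key : ∀ {F : SpaceTime → ℝ}, IsLagrangianInvariant U v F → ∀ i,
      fderiv ℝ (grad F) p (1, v p) i = -∑ j, partialD v i j p * grad F p j := fun hF i => by
    rw [fderiv_grad (hF.1.contDiffAt (hU.mem_nhds hp)), hF.fderiv_fderiv hU hv hp, ← dot_grad]
    rfl
  have hd := hdiv p hp
  rw [fderiv_cross (h1 p hp) (h2 p hp)]
  simp only [divergence, Fin.sum_univ_three] at hd
  ext i
  rw [fderiv_space]
  simp only [Pi.add_apply, cross, cross_apply, key hf, key hf', Fin.sum_univ_three]
  fin_cases i <;> simp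
  · linear_combination -(grad f p 1 * grad f' p 2 - grad f p 2 * grad f' p 1) * hd
  · linear_combination -(grad f p 2 * grad f' p 0 - grad f p 0 * grad f' p 2) * hd
  · linear_combination -(grad f p 0 * grad f' p 1 - grad f p 1 * grad f' p 0) * hd

end Frozen

/-! ### The Poisson bracket -/

section Bracket

variable {U : Set SpaceTime} {v : SpaceTime → R3} {φ f f₁ f₂ f₃ : SpaceTime → ℝ} {p : SpaceTime}

lemma bracket_eq_along : bracket φ f₁ f₂ = along (cross (grad φ) (grad f₁)) f₂ := by
  ext p
  simp only [bracket, along, cross, cross_apply, dotProduct, Fin.sum_univ_three]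
  simp
  ring

lemma bracket_skew : bracket φ f₁ f₂ p = -bracket φ f₂ f₁ p := by
  rw [bracket, bracket, ← cross_anticomm, dotProduct_neg]

lemma bracket_self_left : bracket φ f φ p = 0 := by
  simp only [bracket, cross_apply, dotProduct, Fin.sum_univ_three]
  simp
  ring

lemma bracket_self : bracket φ f f p = 0 := by
  simp [bracket]

lemma bracket_jacobi (hφ : ContDiffAt ℝ ∞ φ p) (h₁ : ContDiffAt ℝ ∞ f₁ p)
    (h₂ : ContDiffAt ℝ ∞ f₂ p) (h₃ : ContDiffAt ℝ ∞ f₃ p) :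
    bracket φ f₁ (bracket φ f₂ f₃) p + bracket φ f₂ (bracket φ f₃ f₁) p
      + bracket φ f₃ (bracket φ f₁ f₂) p = 0 := by
  have key : ∀ {F G : SpaceTime → ℝ}, ContDiffAt ℝ ∞ F p → ContDiffAt ℝ ∞ G p →
      grad (bracket φ F G) p = fun i => (fun j => partialD (grad φ) i j p) ⬝ᵥ (grad F p ⨯₃ grad G p)
        + grad φ p ⬝ᵥ ((fun j => partialD (grad F) i j p) ⨯₃ grad G p
          + grad F p ⨯₃ fun j => partialD (grad G) i j p) := fun hF hG => by
    ext i
    have := fderiv_dot (contDiffAt_grad hφ)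
      (contDiffAt_cross (contDiffAt_grad hF) (contDiffAt_grad hG)) (spaceBasis i)
    rw [fderiv_cross (contDiffAt_grad hF) (contDiffAt_grad hG)] at this
    exact this
  have hb : ∀ F G : SpaceTime → ℝ,
      bracket φ F G p = grad φ p ⬝ᵥ (grad F p ⨯₃ grad G p) := fun _ _ => rfl
  rw [hb f₁, hb f₂, hb f₃, key h₁ h₂, key h₂ h₃, key h₃ h₁]
  simp only [dotProduct, Fin.sum_univ_three, partialD_grad_symm hφ 1 0, partialD_grad_symm hφ 2 0, partialD_grad_symm hφ 2 1,
    partialD_grad_symm h₁ 1 0, partialD_grad_symm h₁ 2 0, partialD_grad_symm h₁ 2 1,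
    partialD_grad_symm h₂ 1 0, partialD_grad_symm h₂ 2 0, partialD_grad_symm h₂ 2 1,
    partialD_grad_symm h₃ 1 0, partialD_grad_symm h₃ 2 0, partialD_grad_symm h₃ 2 1,
    cross_apply, Pi.add_apply, Matrix.cons_val]
  ring

lemma IsLagrangianInvariant.bracket (hU : IsOpen U) (hv : ContDiffOn ℝ ∞ v U)
    (hdiv : ∀ p ∈ U, divergence v p = 0) (hφ : IsLagrangianInvariant U v φ)
    (h₁ : IsLagrangianInvariant U v f₁) (h₂ : IsLagrangianInvariant U v f₂) :
    IsLagrangianInvariant U v (bracket φ f₁ f₂) := by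
  rw [bracket_eq_along]
  exact (IsFrozenIn.cross_grad hU hv hdiv hφ h₁).along hU hv h₂

lemma IsLagrangianInvariant.congr (hU : IsOpen U) (h₁ : IsLagrangianInvariant U v f₁)
    (h : EqOn f₁ f₂ U) : IsLagrangianInvariant U v f₂ := by
  rw [isLagrangianInvariant_iff] at *
  refine ⟨h₁.1.congr fun q hq => (h hq).symm, fun q hq => ?_⟩
  rw [← h₁.2 q hq, (Filter.eventuallyEq_of_mem (hU.mem_nhds hq) h).fderiv_eq]

lemma isPoissonAlgebra_invariants (hU : IsOpen U) (hv : ContDiffOn ℝ ∞ v U)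
    (hdiv : ∀ p ∈ U, divergence v p = 0) (hφ : IsLagrangianInvariant U v φ) :
    IsPoissonAlgebra U φ {f | IsLagrangianInvariant U v f} := by
  have smooth : ∀ {F : SpaceTime → ℝ}, IsLagrangianInvariant U v F → ∀ p ∈ U,
      ContDiffAt ℝ ∞ F p := fun hF p hp => hF.1.contDiffAt (hU.mem_nhds hp)
  have diff : ∀ {F : SpaceTime → ℝ}, IsLagrangianInvariant U v F → ∀ p ∈ U,
      DifferentiableAt ℝ F p := fun hF p hp => (smooth hF p hp).differentiableAt_infty
  refine ⟨fun f hf => hf.1, fun f hf f' hff' => hf.congr hU hff', fun c => ?_, fun f hf f' hf' => ?_,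
    fun f hf f' hf' => ?_, fun f hf f' hf' => hφ.bracket hU hv hdiv hf hf',
    fun f _ f' _ p _ => bracket_skew, fun f hf f₁ hf₁ f₂ hf₂ p hp => ?_,
    fun f hf f₁ hf₁ f₂ hf₂ p hp => ?_, fun f₁ hf₁ f₂ hf₂ f₃ hf₃ p hp =>
      bracket_jacobi (smooth hφ p hp) (smooth hf₁ p hp) (smooth hf₂ p hp) (smooth hf₃ p hp)⟩
  · exact isLagrangianInvariant_iff.2 ⟨contDiffOn_const, fun p _ => by simp⟩
  · refine isLagrangianInvariant_iff.2 ⟨hf.1.add hf'.1, fun p hp => ?_⟩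
    rw [fderiv_fun_add (diff hf p hp) (diff hf' p hp), _root_.add_apply,
      (isLagrangianInvariant_iff.1 hf).2 p hp, (isLagrangianInvariant_iff.1 hf').2 p hp, add_zero]
  · refine isLagrangianInvariant_iff.2 ⟨hf.1.mul hf'.1, fun p hp => ?_⟩
    rw [fderiv_fun_mul (diff hf p hp) (diff hf' p hp), _root_.add_apply, _root_.smul_apply,
      _root_.smul_apply,
      (isLagrangianInvariant_iff.1 hf).2 p hp, (isLagrangianInvariant_iff.1 hf').2 p hp]
    simp
  · simp only [bracket_eq_along, along_apply]
    rw [fderiv_fun_add (diff hf₁ p hp) (diff hf₂ p hp), _root_.add_apply]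
  · simp only [bracket_eq_along, along_apply]
    rw [fderiv_fun_mul (diff hf₁ p hp) (diff hf₂ p hp)]
    simp only [_root_.add_apply, _root_.smul_apply, smul_eq_mul]
    ring

/-- On functions, `∇ × (X × Y)` is minus the commutator of the divergence-free fields `X`, `Y`. -/
lemma along_curl_cross {X Y : SpaceTime → R3} (hX : ContDiffAt ℝ ∞ X p) (hY : ContDiffAt ℝ ∞ Y p)
    (hf : ContDiffAt ℝ ∞ f p) (hdX : divergence X p = 0) (hdY : divergence Y p = 0) :
    along (curl (cross X Y)) f p = along Y (along X f) p - along X (along Y f) p := by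
  rw [along_apply, along_apply Y, along_apply X, fderiv_along hX hf, fderiv_along hY hf,
    curl_cross hX hY, hdX, hdY, fderiv_fderiv_symm hf (0, Y p) (0, X p)]
  have h : ((0, (0 : ℝ) • X p - (0 : ℝ) • Y p + fderiv ℝ X p (0, Y p) - fderiv ℝ Y p (0, X p))
      : SpaceTime) = (0, fderiv ℝ X p (0, Y p)) - (0, fderiv ℝ Y p (0, X p)) := by simp
  rw [h, map_sub]
  ring

end Bracket

/-! ### The hierarchy of symmetries -/

section Hierarchy

variable {U : Set SpaceTime} {v B : SpaceTime → R3} {φ h : SpaceTime → ℝ}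
  {A : ℕ → SpaceTime → R3} {ψ : ℕ → SpaceTime → ℝ} {p : SpaceTime}

lemma ArePotentials.curl_eventuallyEq (hU : IsOpen U) (hpot : ArePotentials U v B φ h A ψ) (k : ℕ)
    (hp : p ∈ U) : curl (A k) =ᶠ[nhds p] symmetryField B φ h k :=
  Filter.eventually_of_mem (hU.mem_nhds hp) (hpot.curl_A k)

lemma ArePotentials.contDiffAt_symmetryField (hU : IsOpen U) (hpot : ArePotentials U v B φ h A ψ)
    (k : ℕ) (hp : p ∈ U) : ContDiffAt ℝ ∞ (symmetryField B φ h k) p :=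
  (contDiffAt_curl ((hpot.smooth_A k).contDiffAt (hU.mem_nhds hp))).congr_of_eventuallyEq
    (hpot.curl_eventuallyEq hU k hp).symm

lemma ArePotentials.divergence_symmetryField (hU : IsOpen U)
    (hpot : ArePotentials U v B φ h A ψ) (k : ℕ) (hp : p ∈ U) :
    divergence (symmetryField B φ h k) p = 0 := by
  rw [← divergence_curl ((hpot.smooth_A k).contDiffAt (hU.mem_nhds hp))]
  simp only [divergence, partialD, (hpot.curl_eventuallyEq hU k hp).fderiv_eq]

/-- The scalar potential of the evolution equation `∂A_k/∂t = ∇ψ + v × (∇ × A_k)`: it is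
`φ + ψ₀` for `k = 0` and `ψ_k` for `k ≥ 1`. -/
def evolutionScalar (φ : SpaceTime → ℝ) (ψ : ℕ → SpaceTime → ℝ) : ℕ → SpaceTime → ℝ
  | 0 => fun q => φ q + ψ 0 q
  | k + 1 => ψ (k + 1)

lemma ArePotentials.contDiffAt_evolutionScalar (hU : IsOpen U) (hs : IsFrozenSystem U v B φ h)
    (hpot : ArePotentials U v B φ h A ψ) (k : ℕ) (hp : p ∈ U) :
    ContDiffAt ℝ ∞ (evolutionScalar φ ψ k) p := by
  cases k with
  | zero =>
    exact (hs.conserved_φ.1.contDiffAt (hU.mem_nhds hp)).add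
      ((hpot.smooth_ψ 0).contDiffAt (hU.mem_nhds hp))
  | succ k => exact (hpot.smooth_ψ (k + 1)).contDiffAt (hU.mem_nhds hp)

lemma ArePotentials.dt_eq (hpot : ArePotentials U v B φ h A ψ) (k : ℕ) (hp : p ∈ U) :
    dt (A k) p = grad (evolutionScalar φ ψ k) p + v p ⨯₃ symmetryField B φ h k p := by
  cases k with
  | zero =>
    have := hpot.scalar_zero p hp
    rw [cross, hpot.curl_A 0 p hp] at this
    exact sub_eq_iff_eq_add.1 this
  | succ k =>
    have := hpot.scalar_pos (k + 1) (by omega) p hp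
    rw [cross, ← cross_anticomm] at this
    rw [evolutionScalar, ← this, neg_add_cancel_right]

lemma ArePotentials.isFrozenIn (hU : IsOpen U) (hv : ContDiffOn ℝ ∞ v U)
    (hs : IsFrozenSystem U v B φ h) (hpot : ArePotentials U v B φ h A ψ) (k : ℕ) :
    IsFrozenIn U v (symmetryField B φ h k) := by
  refine .of_curl hU hv (fun _ hp => hs.divergence_eq_zero hU hv hp)
    (contDiffOn_of_forall fun p hp => hpot.contDiffAt_symmetryField hU k hp)
    (fun p hp => hpot.divergence_symmetryField hU k hp) fun p hp => ?_
  have hA := (hpot.smooth_A k).contDiffAt (hU.mem_nhds hp)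
  have hψ := hpot.contDiffAt_evolutionScalar hU hs k hp
  have h1 : dt (symmetryField B φ h k) p = dt (curl (A k)) p := by
    rw [dt, dt, (hpot.curl_eventuallyEq hU k hp).fderiv_eq]
  have h2 : dt (A k) =ᶠ[nhds p]
      fun q => grad (evolutionScalar φ ψ k) q + cross v (symmetryField B φ h k) q :=
    Filter.eventually_of_mem (hU.mem_nhds hp) fun q hq => hpot.dt_eq k hq
  rw [h1, ← curl_dt hA, curl_congr h2, curl_add (contDiffAt_grad hψ)
    (contDiffAt_cross (hv.contDiffAt (hU.mem_nhds hp)) (hpot.contDiffAt_symmetryField hU k hp)),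
    curl_grad hψ]
  simp

/-- `D(A_k · w)/Dt = w · ∇(ψ + v · A_k)` for a frozen-in field `w`, `ψ` the scalar potential. -/
lemma ArePotentials.fderiv_dot_frozen (hU : IsOpen U) (hv : ContDiffOn ℝ ∞ v U)
    (hs : IsFrozenSystem U v B φ h) (hpot : ArePotentials U v B φ h A ψ) (k : ℕ)
    {w : SpaceTime → R3} (hw : IsFrozenIn U v w) (hp : p ∈ U) :
    fderiv ℝ (fun q => A k q ⬝ᵥ w q) p (1, v p)
      = w p ⬝ᵥ grad (fun q => evolutionScalar φ ψ k q + v q ⬝ᵥ A k q) p := by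
  have hA := (hpot.smooth_A k).contDiffAt (hU.mem_nhds hp)
  have hψ := hpot.contDiffAt_evolutionScalar hU hs k hp
  have hv' := hv.contDiffAt (hU.mem_nhds hp)
  have hg : grad (fun q => evolutionScalar φ ψ k q + v q ⬝ᵥ A k q) p
      = fun i => grad (evolutionScalar φ ψ k) p i + ((fun j => partialD v i j p) ⬝ᵥ A k p
        + v p ⬝ᵥ fun j => partialD (A k) i j p) := by
    ext i
    simp only [grad]
    rw [fderiv_fun_add hψ.differentiableAt_infty (contDiffAt_dot hv' hA).differentiableAt_infty,
      _root_.add_apply, fderiv_dot hv' hA]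
    rfl
  have h2 : ((1, v p) : SpaceTime) = (1, 0) + (0, v p) := by simp
  have h3 : fderiv ℝ (A k) p (1, 0) = dt (A k) p := rfl
  rw [fderiv_dot hA (hw.1.contDiffAt (hU.mem_nhds hp)), hw.2 p hp, h2, map_add, h3,
    hpot.dt_eq k hp, ← hpot.curl_A k p hp, hg]
  simp only [dotProduct, Fin.sum_univ_three, Pi.add_apply, fderiv_space, curl, cross_apply,
    Matrix.cons_val]
  ring

lemma ArePotentials.potVort_invariant (hU : IsOpen U) (hv : ContDiffOn ℝ ∞ v U)
    (hs : IsFrozenSystem U v B φ h) (hpot : ArePotentials U v B φ h A ψ) :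
    ∀ j, IsLagrangianInvariant U v (potVort B φ h j)
  | 0 => hs.conserved_h
  | 1 => (hpot.isFrozenIn hU hv hs 0).along hU hv hs.conserved_h
  | j + 2 => by
    have hP := isPoissonAlgebra_invariants hU hv (fun _ hp => hs.divergence_eq_zero hU hv hp)
      hs.conserved_φ
    have h1 := (hpot.isFrozenIn hU hv hs 1).along hU hv
      (hpot.potVort_invariant hU hv hs (j + 1))
    exact hP.congr _ (hP.mul _ (hP.const (-1)) _ h1) _ fun q _ => by
      simp [potVort, symmetryField]

lemma along_symmetryField_one (f : SpaceTime → ℝ) :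
    along (symmetryField B φ h 1) f = bracket φ h f :=
  bracket_eq_along.symm

/-- One step of the hierarchy acts on `φ` and `h`, both annihilated by `û₁`, as `-û₁`. -/
lemma along_curl_cross_symmetryField {f : SpaceTime → ℝ} {Y : SpaceTime → R3}
    (hX : ContDiffAt ℝ ∞ (symmetryField B φ h 1) p)
    (hY : ContDiffAt ℝ ∞ Y p) (hf : ContDiffAt ℝ ∞ f p)
    (hdX : divergence (symmetryField B φ h 1) p = 0) (hdY : divergence Y p = 0)
    (h0 : ∀ q, bracket φ h f q = 0) :
    along (curl (cross (symmetryField B φ h 1) Y)) f p = -bracket φ h (along Y f) p := by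
  rw [along_curl_cross hX hY hf hdX hdY, along_symmetryField_one, along_symmetryField_one,
    funext h0, along_apply Y]
  simp

/-- The derivatives `û_l(f)`, `f = φ` or `f = h`, lie in every Poisson algebra that contains
`û₀(f)`. -/
lemma ArePotentials.along_symmetryField_mem (hU : IsOpen U)
    (hpot : ArePotentials U v B φ h A ψ)
    {S : Set (SpaceTime → ℝ)} (hS : IsPoissonAlgebra U φ S) {f : SpaceTime → ℝ}
    (hh : h ∈ S) (hf : f ∈ S) (h0 : ∀ q, bracket φ h f q = 0) (hB : along B f ∈ S) :
    ∀ l, along (symmetryField B φ h l) f ∈ S := by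
  have step : ∀ Y, (∀ p ∈ U, ContDiffAt ℝ ∞ Y p) → (∀ p ∈ U, divergence Y p = 0) →
      along Y f ∈ S → along (curl (cross (symmetryField B φ h 1) Y)) f ∈ S := by
    intro Y hY hdY hYf
    refine hS.congr _ (hS.mul _ (hS.const (-1)) _ (hS.bracket_mem _ hh _ hYf)) _ fun q hq => ?_
    rw [along_curl_cross_symmetryField (hpot.contDiffAt_symmetryField hU 1 hq) (hY q hq)
      ((hS.smooth f hf).contDiffAt (hU.mem_nhds hq)) (hpot.divergence_symmetryField hU 1 hq)
      (hdY q hq) h0]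
    simp
  have step' : ∀ l, along (symmetryField B φ h l) f ∈ S →
      along (curl (cross (symmetryField B φ h 1) (symmetryField B φ h l))) f ∈ S := fun l =>
    step _ (fun p hp => hpot.contDiffAt_symmetryField hU l hp)
      (fun p hp => hpot.divergence_symmetryField hU l hp)
  have h2 : ∀ l, along (symmetryField B φ h (l + 2)) f ∈ S := by
    intro l
    induction l with
    | zero => exact step' 0 hB
    | succ l ih => exact step' (l + 2) ih
  rintro (_ | _ | l)
  · exact hB
  · rw [along_symmetryField_one, funext h0]
    exact hS.const 0
  · exact h2 l

end Hierarchy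

/-! ### Evaluation and differentiation of forms -/

section Forms

open ContinuousAlternatingMap

variable {p : SpaceTime}

lemma toForm_apply (α : SpaceTime → SpaceTime →L[ℝ] ℝ) (u : Fin 1 → SpaceTime) :
    toForm α p u = α p (u 0) := by
  simp [toForm]

lemma wedge_apply_two (α : SpaceTime →L[ℝ] ℝ) (β : SpaceTime [⋀^Fin 1]→L[ℝ] ℝ)
    (u : Fin 2 → SpaceTime) : wedge α β u = α (u 0) * β ![u 1] - α (u 1) * β ![u 0] := by
  have h0 : Fin.removeNth 0 u = ![u 1] := by ext i <;> fin_cases i <;> rfl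
  have h1 : Fin.removeNth 1 u = ![u 0] := by ext i <;> fin_cases i <;> rfl
  simp [wedge, alternatizeUncurryFin_apply, Fin.sum_univ_two, h0, h1, sub_eq_add_neg]

lemma wedge₁_apply (α β : SpaceTime →L[ℝ] ℝ) (u : Fin 2 → SpaceTime) :
    wedge₁ α β u = α (u 0) * β (u 1) - α (u 1) * β (u 0) := by
  simp [wedge₁, wedge_apply_two]

lemma wedge_apply_three (α : SpaceTime →L[ℝ] ℝ) (β : SpaceTime [⋀^Fin 2]→L[ℝ] ℝ)
    (u : Fin 3 → SpaceTime) :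
    wedge α β u
      = α (u 0) * β ![u 1, u 2] - α (u 1) * β ![u 0, u 2] + α (u 2) * β ![u 0, u 1] := by
  have h0 : Fin.removeNth 0 u = ![u 1, u 2] := by ext i <;> fin_cases i <;> rfl
  have h1 : Fin.removeNth 1 u = ![u 0, u 2] := by ext i <;> fin_cases i <;> rfl
  have h2 : Fin.removeNth 2 u = ![u 0, u 1] := by ext i <;> fin_cases i <;> rfl
  simp [wedge, alternatizeUncurryFin_apply, Fin.sum_univ_three, h0, h1, h2, sub_eq_add_neg]

lemma dotDx_apply (w : R3) (a : SpaceTime) : dotDx w a = w ⬝ᵥ a.2 := by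
  simp [dotDx, dX, dotProduct]

lemma dotDxDx_apply (w : R3) (u : Fin 2 → SpaceTime) :
    dotDxDx w u = w ⬝ᵥ ((u 0).2 ⨯₃ (u 1).2) := by
  simp only [dotDxDx, ContinuousAlternatingMap.add_apply, ContinuousAlternatingMap.smul_apply,
    wedge₁_apply, dotProduct, Fin.sum_univ_three, cross_apply, dX]
  simp
  ring

lemma toForm_eq (α : SpaceTime → SpaceTime →L[ℝ] ℝ) :
    toForm α = (ofSubsingletonLIE (𝕜 := ℝ) (E := SpaceTime) (F := ℝ)
      (0 : Fin 1)).toContinuousLinearEquiv ∘ α := rfl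

lemma contDiffAt_toForm {α : SpaceTime → SpaceTime →L[ℝ] ℝ} (hα : ContDiffAt ℝ ∞ α p) :
    ContDiffAt ℝ ∞ (toForm α) p := by
  rw [toForm_eq]
  exact (ContinuousLinearEquiv.contDiff _).contDiffAt.comp p hα

lemma fderiv_toForm (α : SpaceTime → SpaceTime →L[ℝ] ℝ) (a : SpaceTime) (u : Fin 1 → SpaceTime) :
    fderiv ℝ (toForm α) p a u = fderiv ℝ α p a (u 0) := by
  rw [toForm_eq, ContinuousLinearEquiv.comp_fderiv]
  simp

lemma extDeriv_toForm_apply (α : SpaceTime → SpaceTime →L[ℝ] ℝ) (u : Fin 2 → SpaceTime) :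
    extDeriv (toForm α) p u = fderiv ℝ α p (u 0) (u 1) - fderiv ℝ α p (u 1) (u 0) := by
  simp [extDeriv, alternatizeUncurryFin_apply, Fin.sum_univ_two, fderiv_toForm, sub_eq_add_neg,
    Fin.removeNth]

lemma contDiffAt_extDeriv {n : ℕ} {β : SpaceTime → SpaceTime [⋀^Fin n]→L[ℝ] ℝ}
    (hβ : ContDiffAt ℝ ∞ β p) : ContDiffAt ℝ ∞ (extDeriv β) p := by
  have h : extDeriv β = alternatizeUncurryFinCLM ℝ SpaceTime ℝ ∘ fderiv ℝ β := rfl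
  rw [h]
  exact (ContinuousLinearMap.contDiff _).contDiffAt.comp p (hβ.fderiv_right (m := ∞) (by simp))

lemma extDeriv_extDeriv_eq_zero {n : ℕ} {β : SpaceTime → SpaceTime [⋀^Fin n]→L[ℝ] ℝ}
    (hβ : ContDiffAt ℝ ∞ β p) : extDeriv (extDeriv β) p = 0 :=
  extDeriv_extDeriv_apply hβ (by simpa using ENat.LEInfty.out)

lemma extDeriv_smul_fun {n : ℕ} {χ : SpaceTime → ℝ}
    {β : SpaceTime → SpaceTime [⋀^Fin n]→L[ℝ] ℝ}
    (hχ : ContDiffAt ℝ ∞ χ p) (hβ : ContDiffAt ℝ ∞ β p) :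
    extDeriv (fun q => χ q • β q) p = wedge (fderiv ℝ χ p) (β p) + χ p • extDeriv β p := by
  rw [extDeriv, fderiv_fun_smul hχ.differentiableAt_infty hβ.differentiableAt_infty,
    alternatizeUncurryFin_add, alternatizeUncurryFin_smul]
  exact add_comm _ _

lemma extDeriv_toForm_fderiv {χ : SpaceTime → ℝ} (hχ : ContDiffAt ℝ ∞ χ p) :
    extDeriv (toForm (fderiv ℝ χ)) p = 0 := by
  ext u
  rw [extDeriv_toForm_apply, fderiv_fderiv_symm hχ, sub_self]
  rfl

lemma fst_snd_fderiv_apply {f : SpaceTime → ℝ} (a : SpaceTime) :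
    fderiv ℝ f p a = a.1 * dt f p + a.2 ⬝ᵥ grad f p := by
  have h : a = a.1 • (1, 0) + (0, a.2) := by ext <;> simp
  conv_lhs => rw [h]
  rw [map_add, map_smul, dot_grad]
  rfl

lemma fst_snd_fderiv_apply_vec {F : SpaceTime → R3} (a : SpaceTime) (j : Fin 3) :
    fderiv ℝ F p a j = a.1 * dt F p j + ∑ i, a.2 i * partialD F i j p := by
  have h : a = a.1 • (1, 0) + (0, a.2) := by ext <;> simp
  conv_lhs => rw [h]
  rw [map_add, map_smul, Pi.add_apply, fderiv_space]
  rfl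

/-- The one-form `ψ dt + A · dx`. -/
def potentialForm (ψ : SpaceTime → ℝ) (A : SpaceTime → R3) : SpaceTime → SpaceTime →L[ℝ] ℝ :=
  fun q => ψ q • dT + dotDx (A q)

variable {ψ : SpaceTime → ℝ} {A : SpaceTime → R3}

lemma contDiffAt_potentialForm (hψ : ContDiffAt ℝ ∞ ψ p) (hA : ContDiffAt ℝ ∞ A p) :
    ContDiffAt ℝ ∞ (potentialForm ψ A) p :=
  (hψ.smul contDiffAt_const).add
    (ContDiffAt.sum fun i _ => (contDiffAt_pi.1 hA i).smul contDiffAt_const)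

lemma fderiv_potentialForm (hψ : ContDiffAt ℝ ∞ ψ p) (hA : ContDiffAt ℝ ∞ A p) (a b : SpaceTime) :
    fderiv ℝ (potentialForm ψ A) p a b = fderiv ℝ ψ p a * b.1 + fderiv ℝ A p a ⬝ᵥ b.2 := by
  have h1 : fderiv ℝ (fun q => potentialForm ψ A q b) p a = fderiv ℝ (potentialForm ψ A) p a b := by
    rw [fderiv_clm_apply (contDiffAt_potentialForm hψ hA).differentiableAt_infty
      (differentiableAt_const b)]
    simp
  have h2 : (fun q => potentialForm ψ A q b) = fun q => ψ q * b.1 + A q ⬝ᵥ b.2 := by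
    ext q
    simp [potentialForm, dT, dotDx_apply]
  have hb : ContDiffAt ℝ ∞ (fun _ : SpaceTime => b.2) p := contDiffAt_const
  rw [← h1, h2, fderiv_fun_add (hψ.differentiableAt_infty.mul_const _)
    (contDiffAt_dot hA hb).differentiableAt_infty, _root_.add_apply, fderiv_dot hA hb,
    fderiv_mul_const hψ.differentiableAt_infty]
  simp [mul_comm]

/-- `d(ψ dt + A · dx) = (∇ψ - ∂A/∂t) · dx ∧ dt + (∇ × A) · dx ∧ dx`. -/
lemma extDeriv_potentialForm (hψ : ContDiffAt ℝ ∞ ψ p) (hA : ContDiffAt ℝ ∞ A p) :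
    extDeriv (toForm (potentialForm ψ A)) p
      = wedge₁ (dotDx (grad ψ p - dt A p)) dT + dotDxDx (curl A p) := by
  ext u
  rw [extDeriv_toForm_apply, fderiv_potentialForm hψ hA, fderiv_potentialForm hψ hA,
    ContinuousAlternatingMap.add_apply, wedge₁_apply, dotDxDx_apply, dotDx_apply, dotDx_apply,
    fst_snd_fderiv_apply, fst_snd_fderiv_apply]
  have hT : ∀ a : SpaceTime, dT a = a.1 := fun _ => rfl
  simp only [dotProduct, Fin.sum_univ_three, fst_snd_fderiv_apply_vec, curl, cross_apply,
    Matrix.cons_val, hT, Pi.sub_apply]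
  ring

end Forms

/-! ### The forms of the hierarchy -/

section Hierarchy

variable {U : Set SpaceTime} {v B : SpaceTime → R3} {φ h : SpaceTime → ℝ}
  {A : ℕ → SpaceTime → R3} {ψ : ℕ → SpaceTime → ℝ} {p : SpaceTime}

/-- The sign in `θ_k = ± (ψ_k dt + A_k · dx)`. -/
def formSign : ℕ → ℝ
  | 0 => -1
  | _ + 1 => 1

lemma theta_eq (k : ℕ) : theta A ψ k = fun p => formSign k • potentialForm (ψ k) (A k) p := by
  cases k <;> simp [theta, formSign, potentialForm, add_comm]

lemma chi_eq (k : ℕ) :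
    chi v φ A ψ k = fun p => formSign k * (evolutionScalar φ ψ k p + v p ⬝ᵥ A k p) := by
  cases k <;> ext p <;> simp [chi, formSign, evolutionScalar]
  ring

lemma ArePotentials.contDiffAt_potentialForm (hU : IsOpen U) (hpot : ArePotentials U v B φ h A ψ)
    (k : ℕ) (hp : p ∈ U) : ContDiffAt ℝ ∞ (potentialForm (ψ k) (A k)) p :=
  VorticityConservation.contDiffAt_potentialForm ((hpot.smooth_ψ k).contDiffAt (hU.mem_nhds hp))
    ((hpot.smooth_A k).contDiffAt (hU.mem_nhds hp))

lemma ArePotentials.contDiffAt_theta (hU : IsOpen U) (hpot : ArePotentials U v B φ h A ψ) (k : ℕ)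
    (hp : p ∈ U) : ContDiffAt ℝ ∞ (theta A ψ k) p := by
  rw [theta_eq]
  exact (hpot.contDiffAt_potentialForm hU k hp).const_smul (formSign k)

lemma ArePotentials.contDiffAt_dTheta (hU : IsOpen U) (hpot : ArePotentials U v B φ h A ψ) (k : ℕ)
    (hp : p ∈ U) : ContDiffAt ℝ ∞ (dTheta A ψ k) p :=
  contDiffAt_extDeriv (contDiffAt_toForm (hpot.contDiffAt_theta hU k hp))

lemma ArePotentials.contDiffAt_chi (hU : IsOpen U) (hv : ContDiffOn ℝ ∞ v U)
    (hs : IsFrozenSystem U v B φ h) (hpot : ArePotentials U v B φ h A ψ) (k : ℕ) (hp : p ∈ U) :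
    ContDiffAt ℝ ∞ (chi v φ A ψ k) p := by
  rw [chi_eq]
  exact contDiffAt_const.mul ((hpot.contDiffAt_evolutionScalar hU hs k hp).add
    (contDiffAt_dot (hv.contDiffAt (hU.mem_nhds hp))
      ((hpot.smooth_A k).contDiffAt (hU.mem_nhds hp))))

/-- `dθ_k = ± ((∇ψ_k - ∂A_k/∂t) · dx ∧ dt + û_k · dx ∧ dx)`. -/
lemma ArePotentials.dTheta_eq (hU : IsOpen U) (hpot : ArePotentials U v B φ h A ψ) (k : ℕ)
    (hp : p ∈ U) :
    dTheta A ψ k p = formSign k • (wedge₁ (dotDx (grad (ψ k) p - dt (A k) p)) dT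
      + dotDxDx (symmetryField B φ h k p)) := by
  have h1 : toForm (theta A ψ k) = formSign k • toForm (potentialForm (ψ k) (A k)) := by
    ext q u
    simp [toForm_apply, theta_eq]
  rw [dTheta, h1, extDeriv_smul, extDeriv_potentialForm
    ((hpot.smooth_ψ k).contDiffAt (hU.mem_nhds hp)) ((hpot.smooth_A k).contDiffAt (hU.mem_nhds hp)),
    hpot.curl_A k p hp]

lemma ArePotentials.Theta_eq (hU : IsOpen U) (hs : IsFrozenSystem U v B φ h)
    (hpot : ArePotentials U v B φ h A ψ) (k : ℕ) (hp : p ∈ U) :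
    Theta v B φ h k p = -dTheta A ψ k p := by
  have hdt := hpot.dt_eq k hp
  rw [hpot.dTheta_eq hU k hp, hdt]
  ext u
  cases k with
  | zero =>
    have h1 : grad (evolutionScalar φ ψ 0) p = grad φ p + grad (ψ 0) p := by
      ext i
      simp only [grad, evolutionScalar, Pi.add_apply]
      rw [fderiv_fun_add (hs.conserved_φ.1.contDiffAt (hU.mem_nhds hp)).differentiableAt_infty
        ((hpot.smooth_ψ 0).contDiffAt (hU.mem_nhds hp)).differentiableAt_infty, _root_.add_apply]
    simp only [Theta, symplecticForm, symmetryField, formSign, h1,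
      ContinuousAlternatingMap.add_apply, ContinuousAlternatingMap.neg_apply,
      ContinuousAlternatingMap.smul_apply, wedge₁_apply, dotDx_apply, cross, smul_eq_mul,
      sub_dotProduct, add_dotProduct]
    ring
  | succ k =>
    have h1 : symmetryField B φ h (k + 1) p ⨯₃ v p = -(v p ⨯₃ symmetryField B φ h (k + 1) p) :=
      (cross_anticomm _ _).symm
    simp only [Theta, formSign, evolutionScalar, h1,
      ContinuousAlternatingMap.add_apply, ContinuousAlternatingMap.sub_apply,
      ContinuousAlternatingMap.neg_apply,
      ContinuousAlternatingMap.smul_apply, wedge₁_apply, dotDx_apply, cross, smul_eq_mul,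
      sub_dotProduct, add_dotProduct, neg_dotProduct]
    ring

/-- The contraction of `dθ_k` with `∂ₜ + v` is `-dφ` for `k = 0` and zero for `k ≥ 1`. With
`θ_k(∂ₜ + v)` it adds up to `dχ_k`; on `φ` invariance is used. -/
lemma ArePotentials.dTheta_transport (hU : IsOpen U) (hv : ContDiffOn ℝ ∞ v U)
    (hs : IsFrozenSystem U v B φ h) (hpot : ArePotentials U v B φ h A ψ) (k : ℕ) (hp : p ∈ U)
    (b : SpaceTime) :
    dTheta A ψ k p ![(1, v p), b] + fderiv ℝ (fun q => theta A ψ k q (1, v q)) p b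
      = fderiv ℝ (chi v φ A ψ k) p b := by
  have hψ := (hpot.smooth_ψ k).contDiffAt (hU.mem_nhds hp)
  have hA := (hpot.smooth_A k).contDiffAt (hU.mem_nhds hp)
  have hvp := hv.contDiffAt (hU.mem_nhds hp)
  have hvA := contDiffAt_dot hvp hA
  have hW := hpot.contDiffAt_evolutionScalar hU hs k hp
  have h1 : (fun q => theta A ψ k q (1, v q))
      = fun q => formSign k * (ψ k q + v q ⬝ᵥ A k q) := by
    ext q
    simp [theta_eq, potentialForm, dT, dotDx_apply, dotProduct_comm, mul_add]
  have h3 : fderiv ℝ (evolutionScalar φ ψ k) p b - fderiv ℝ (ψ k) p b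
      = b.2 ⬝ᵥ (grad (evolutionScalar φ ψ k) p - grad (ψ k) p)
        - b.1 * (v p ⬝ᵥ (grad (evolutionScalar φ ψ k) p - grad (ψ k) p)) := by
    cases k with
    | zero =>
      have hφ := hs.conserved_φ.1.contDiffAt (hU.mem_nhds hp)
      have h4 : fderiv ℝ (evolutionScalar φ ψ 0) p = fderiv ℝ φ p + fderiv ℝ (ψ 0) p :=
        fderiv_fun_add hφ.differentiableAt_infty hψ.differentiableAt_infty
      have h5 : grad (evolutionScalar φ ψ 0) p - grad (ψ 0) p = grad φ p := by
        ext i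
        simp [grad, h4]
      have h6 := hs.conserved_φ.2 p hp
      rw [h5, h4, _root_.add_apply, add_sub_cancel_right, fst_snd_fderiv_apply]
      simp only [along] at h6
      linear_combination b.1 * h6
    | succ k => simp [evolutionScalar]
  rw [h1, chi_eq, fderiv_const_mul (hψ.add hvA).differentiableAt_infty,
    fderiv_const_mul (hW.add hvA).differentiableAt_infty, fderiv_fun_add hψ.differentiableAt_infty
    hvA.differentiableAt_infty, fderiv_fun_add hW.differentiableAt_infty hvA.differentiableAt_infty,
    hpot.dTheta_eq hU k hp, hpot.dt_eq k hp]
  have hT : ∀ a : SpaceTime, dT a = a.1 := fun _ => rfl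
  simp only [ContinuousAlternatingMap.add_apply, ContinuousAlternatingMap.smul_apply,
    wedge₁_apply, dotDx_apply, dotDxDx_apply, smul_eq_mul, _root_.smul_apply, _root_.add_apply, hT]
  rw [← sub_eq_zero]
  simp only [dotProduct, Fin.sum_univ_three, cross_apply, Matrix.cons_val, Pi.sub_apply,
    Pi.add_apply] at h3 ⊢
  linear_combination (-formSign k) * h3

/-- The helicity density is `± A_k · û_l`. -/
lemma ArePotentials.helicityDensity_eq (hU : IsOpen U) (hpot : ArePotentials U v B φ h A ψ)
    (k l : ℕ) (hp : p ∈ U) :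
    helicityDensity A ψ k l p
      = formSign k * formSign l * (A k p ⬝ᵥ symmetryField B φ h l p) := by
  have hT : ∀ a : SpaceTime, dT a = a.1 := fun _ => rfl
  have h1 : ∀ i, theta A ψ k p (spaceBasis i) = formSign k * A k p i := fun i => by
    simp [theta_eq, potentialForm, dotDx_apply, hT, spaceBasis]
  have h2 : ∀ i j, dTheta A ψ l p ![spaceBasis i, spaceBasis j]
      = formSign l * (symmetryField B φ h l p ⬝ᵥ
        ((Pi.single i 1 : R3) ⨯₃ (Pi.single j 1 : R3))) := fun i j => by
    rw [hpot.dTheta_eq hU l hp]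
    simp only [ContinuousAlternatingMap.add_apply, ContinuousAlternatingMap.smul_apply,
      wedge₁_apply, dotDxDx_apply, hT, spaceBasis]
    simp
  rw [helicityDensity, helicityForm, wedge_apply_three, h1, h1, h1, h2, h2, h2]
  simp [cross_apply, dotProduct, Fin.sum_univ_three]
  ring

lemma ArePotentials.helicityDensity_invariant (hU : IsOpen U) (hv : ContDiffOn ℝ ∞ v U)
    (hs : IsFrozenSystem U v B φ h) (hpot : ArePotentials U v B φ h A ψ) (k l : ℕ)
    (htan : ∀ p ∈ U, symmetryField B φ h l p ⬝ᵥ grad (chi v φ A ψ k) p = 0) :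
    IsLagrangianInvariant U v (helicityDensity A ψ k l) := by
  have hfr := hpot.isFrozenIn hU hv hs l
  have hsm : ∀ p ∈ U, ContDiffAt ℝ ∞ (fun q => A k q ⬝ᵥ symmetryField B φ h l q) p :=
    fun p hp => contDiffAt_dot ((hpot.smooth_A k).contDiffAt (hU.mem_nhds hp))
      (hpot.contDiffAt_symmetryField hU l hp)
  have h1 : IsLagrangianInvariant U v
      (fun q => formSign k * formSign l * (A k q ⬝ᵥ symmetryField B φ h l q)) := by
    refine isLagrangianInvariant_iff.2
      ⟨contDiffOn_const.mul (contDiffOn_of_forall hsm), fun p hp => ?_⟩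
    rw [fderiv_const_mul (hsm p hp).differentiableAt_infty, _root_.smul_apply,
      hpot.fderiv_dot_frozen hU hv hs k hfr hp]
    have h2 := htan p hp
    have h3 : grad (chi v φ A ψ k) p
        = formSign k • grad (fun q => evolutionScalar φ ψ k q + v q ⬝ᵥ A k q) p := by
      ext i
      simp only [grad, chi_eq, Pi.smul_apply]
      rw [fderiv_const_mul ((hpot.contDiffAt_evolutionScalar hU hs k hp).add
        (contDiffAt_dot (hv.contDiffAt (hU.mem_nhds hp))
          ((hpot.smooth_A k).contDiffAt (hU.mem_nhds hp)))).differentiableAt_infty]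
      rfl
    rw [h3, dotProduct_smul, smul_eq_mul] at h2
    rw [smul_eq_mul]
    linear_combination formSign l * h2
  exact h1.congr hU fun p hp => (hpot.helicityDensity_eq hU k l hp).symm

/-- With `A_k = û₁ × û_{k-1}` and `û₁ = ∇φ × ∇h`, the density `A_k · û_l` is a polynomial in the
derivatives of `φ` and `h` along `û_{k-1}` and `û_l`, which lie in the Poisson algebra. -/
lemma ArePotentials.helicityDensity_mem (hU : IsOpen U) (hs : IsFrozenSystem U v B φ h)
    (hpot : ArePotentials U v B φ h A ψ) (j l : ℕ)
    (hA : EqOn (A (j + 1)) (explicitPotential B φ h j) U)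
    {S : Set (SpaceTime → ℝ)} (hS : IsPoissonAlgebra U φ S) (hφ : φ ∈ S)
    (hpv : ∀ i, potVort B φ h i ∈ S) : helicityDensity A ψ (j + 1) l ∈ S := by
  have hh : h ∈ S := hpv 0
  have uh : ∀ l, along (symmetryField B φ h l) h ∈ S :=
    hpot.along_symmetryField_mem hU hS hh hh (fun _ => bracket_self) (hpv 1)
  have uφ : ∀ l, along (symmetryField B φ h l) φ ∈ S := by
    refine hpot.along_symmetryField_mem hU hS hh hφ (fun _ => bracket_self_left)
      (hS.congr _ (hS.const (-1)) _ fun q hq => ?_)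
    have := hs.density q hq
    simp only [along]
    linarith
  have triple : ∀ m, (fun p => formSign (j + 1) * formSign l *
      (cross (symmetryField B φ h 1) (symmetryField B φ h m) p ⬝ᵥ symmetryField B φ h l p)) ∈ S := by
    intro m
    have h1 := hS.mul _ (uh l) _ (uφ m)
    have h2 := hS.mul _ (hS.const (-1)) _ (hS.mul _ (uφ l) _ (uh m))
    refine hS.congr _ (hS.mul _ (hS.const (formSign (j + 1) * formSign l)) _
      (hS.add _ h1 _ h2)) _ fun q _ => ?_
    simp only [along, symmetryField, cross, cross_apply, dotProduct, Fin.sum_univ_three,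
      Matrix.cons_val]
    ring
  have dens : EqOn (helicityDensity A ψ (j + 1) l)
      (fun p => formSign (j + 1) * formSign l *
        (explicitPotential B φ h j p ⬝ᵥ symmetryField B φ h l p)) U := fun p hp => by
    rw [hpot.helicityDensity_eq hU _ _ hp, hA hp]
  match j with
  | 0 =>
    refine hS.congr _ (hS.mul _ (hS.const (formSign 1 * formSign l)) _
      (hS.mul _ hφ _ (uh l))) _ fun p hp => ?_
    rw [dens hp]
    simp only [explicitPotential, smul_dotProduct, along, dotProduct_comm (grad h p), smul_eq_mul]
  | 1 => exact hS.congr _ (triple 0) _ dens.symm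
  | j + 2 => exact hS.congr _ (triple (j + 2)) _ dens.symm

end Hierarchy

/-! ### Stokes' theorem for smooth cubes and chains -/

section Stokes

open MeasureTheory

variable {n : ℕ} {U : Set SpaceTime}

lemma uniqueDiffOn_cube (n : ℕ) : UniqueDiffOn ℝ (Icc (0 : Fin n → ℝ) 1) := by
  rw [← pi_univ_Icc]
  exact UniqueDiffOn.univ_pi fun i => uniqueDiffOn_Icc zero_lt_one

lemma cubeExt_eq (c : SingularCube n) {y : Fin n → ℝ} (hy : y ∈ Icc (0 : Fin n → ℝ) 1) :
    cubeExt c y = c fun i => ⟨y i, hy.1 i, hy.2 i⟩ := by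
  simp only [cubeExt]
  congr 1
  ext i
  rw [projIcc_of_mem zero_le_one ⟨hy.1 i, hy.2 i⟩]

lemma IsSmoothCube.contDiffOn_fderivWithin {c : SingularCube n} (hc : IsSmoothCube c) :
    ContDiffOn ℝ ∞ (fderivWithin ℝ (cubeExt c) (Icc 0 1)) (Icc 0 1) :=
  hc.fderivWithin (uniqueDiffOn_cube n) (by simp)

lemma IsSmoothCube.continuousOn_cubeTangent {c : SingularCube n} (hc : IsSmoothCube c) :
    ContinuousOn (cubeTangent c) (Icc 0 1) :=
  continuousOn_pi.2 fun _ =>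
    hc.contDiffOn_fderivWithin.continuousOn.clm_apply continuousOn_const

lemma IsSmoothCube.continuousOn_integrand {c : SingularCube n} (hc : IsSmoothCube c)
    (hcU : ∀ y, c y ∈ U) {β : SpaceTime → SpaceTime [⋀^Fin n]→L[ℝ] ℝ} (hβ : ContinuousOn β U) :
    ContinuousOn (fun y => β (cubeExt c y) (cubeTangent c y)) (Icc 0 1) :=
  (hβ.comp hc.continuousOn fun _ _ => hcU _).eval hc.continuousOn_cubeTangent

/-- The linear part of the inclusion of the face on which the `i`-th coordinate is constant. -/
def faceInclusion (i : Fin (n + 1)) : (Fin n → ℝ) →L[ℝ] (Fin (n + 1) → ℝ) :=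
  ContinuousLinearMap.pi
    (Fin.insertNth i (0 : (Fin n → ℝ) →L[ℝ] ℝ) fun j => ContinuousLinearMap.proj j)

lemma insertNth_eq_faceInclusion (i : Fin (n + 1)) (s : ℝ) (y : Fin n → ℝ) :
    (Fin.insertNth i s y : Fin (n + 1) → ℝ) = faceInclusion i y + Pi.single i s := by
  ext k
  refine Fin.succAboveCases i ?_ (fun j => ?_) k <;> simp [faceInclusion]

lemma faceInclusion_single (i : Fin (n + 1)) (j : Fin n) :
    faceInclusion i (Pi.single j 1) = Pi.single (i.succAbove j) 1 := by
  ext k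
  refine Fin.succAboveCases i ?_ (fun l => ?_) k
  · simp [faceInclusion]
  · simp [faceInclusion, Pi.single_apply]

lemma insertNth_mem_cube (i : Fin (n + 1)) (s : unitInterval) {y : Fin n → ℝ}
    (hy : y ∈ Icc (0 : Fin n → ℝ) 1) :
    (Fin.insertNth i (s : ℝ) y : Fin (n + 1) → ℝ) ∈ Icc (0 : Fin (n + 1) → ℝ) 1 := by
  refine ⟨fun k => ?_, fun k => ?_⟩ <;> refine Fin.succAboveCases i ?_ (fun j => ?_) k
  · simpa using s.2.1
  · simpa using hy.1 j
  · simpa using s.2.2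
  · simpa using hy.2 j

lemma cubeExt_face (c : SingularCube (n + 1)) (i : Fin (n + 1)) (s : unitInterval) :
    cubeExt (face c i s) = cubeExt c ∘ fun y => Fin.insertNth i (s : ℝ) y := by
  ext1 y
  simp only [cubeExt, face, Function.comp]
  congr 1
  ext k
  refine Fin.succAboveCases i ?_ (fun j => ?_) k <;> simp

lemma cubeTangent_face {c : SingularCube (n + 1)} (hc : IsSmoothCube c) (i : Fin (n + 1))
    (s : unitInterval) {y : Fin n → ℝ} (hy : y ∈ Icc (0 : Fin n → ℝ) 1) :
    cubeTangent (face c i s) y = i.removeNth (cubeTangent c (Fin.insertNth i (s : ℝ) y)) := by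
  have h1 : HasFDerivAt (fun y : Fin n → ℝ => (Fin.insertNth i (s : ℝ) y : Fin (n + 1) → ℝ))
      (faceInclusion i) y := by
    have : (fun y : Fin n → ℝ => (Fin.insertNth i (s : ℝ) y : Fin (n + 1) → ℝ))
        = fun y => faceInclusion i y + Pi.single i (s : ℝ) :=
      funext fun y => insertNth_eq_faceInclusion i s y
    rw [this]
    exact (faceInclusion i).hasFDerivAt.add_const _
  have h2 := uniqueDiffOn_cube n y hy
  ext1 j
  rw [cubeTangent, cubeExt_face, fderivWithin_comp y (t := Icc 0 1)
    (hc.differentiableOn (by simp) _ (insertNth_mem_cube i s hy))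
    h1.differentiableAt.differentiableWithinAt (fun z hz => insertNth_mem_cube i s hz) h2,
    h1.hasFDerivWithinAt.fderivWithin h2, ContinuousLinearMap.comp_apply, faceInclusion_single]
  rfl

lemma chainIntegral_single (c : SingularCube n) (m : ℤ)
    (β : SpaceTime → SpaceTime [⋀^Fin n]→L[ℝ] ℝ) :
    chainIntegral (Finsupp.single c m) β = m * cubeIntegral c β := by
  simp [chainIntegral]

/-- Integration of a fixed form, as an additive map on chains. -/
def chainIntegralHom (β : SpaceTime → SpaceTime [⋀^Fin n]→L[ℝ] ℝ) : Chain n →+ ℝ :=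
  Finsupp.liftAddHom fun c => (AddMonoidHom.mulRight (cubeIntegral c β)).comp (Int.castAddHom ℝ)

lemma chainIntegralHom_apply (S : Chain n) (β : SpaceTime → SpaceTime [⋀^Fin n]→L[ℝ] ℝ) :
    chainIntegralHom β S = chainIntegral S β := rfl

lemma chainIntegral_cubeBoundary (c : SingularCube (n + 1))
    (β : SpaceTime → SpaceTime [⋀^Fin n]→L[ℝ] ℝ) :
    chainIntegral (cubeBoundary c) β = ∑ i : Fin (n + 1), (-1) ^ (i : ℕ) *
      (cubeIntegral (face c i 1) β - cubeIntegral (face c i 0) β) := by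
  rw [← chainIntegralHom_apply, cubeBoundary, map_sum]
  refine Finset.sum_congr rfl fun i _ => ?_
  rw [map_zsmul, map_sub, chainIntegralHom_apply, chainIntegralHom_apply, chainIntegral_single,
    chainIntegral_single]
  simp

lemma chainIntegral_boundary (S : Chain (n + 1)) (β : SpaceTime → SpaceTime [⋀^Fin n]→L[ℝ] ℝ) :
    chainIntegral (boundary S) β = S.sum fun c m => (m : ℝ) * chainIntegral (cubeBoundary c) β := by
  rw [← chainIntegralHom_apply, boundary, Finsupp.sum, map_sum, Finsupp.sum]
  refine Finset.sum_congr rfl fun c _ => ?_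
  rw [map_zsmul, chainIntegralHom_apply, zsmul_eq_mul]

lemma interior_ae_eq_cube (n : ℕ) :
    (pi univ fun _ : Fin n => Ioo (0 : ℝ) 1) =ᵐ[volume] Icc (0 : Fin n → ℝ) 1 :=
  Measure.univ_pi_Ioo_ae_eq_Icc (f := (0 : Fin n → ℝ)) (g := 1)

/-- **Stokes' theorem** for a cube that is smooth up to its boundary: the pullback of `dβ` is the
divergence of the components of the pullback of `β`. -/
theorem cubeIntegral_extDeriv (hU : IsOpen U) {β : SpaceTime → SpaceTime [⋀^Fin n]→L[ℝ] ℝ}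
    (hβ : ContDiffOn ℝ ∞ β U) {c : SingularCube (n + 1)} (hc : IsSmoothCube c)
    (hcU : ∀ y, c y ∈ U) :
    cubeIntegral c (extDeriv β) = chainIntegral (cubeBoundary c) β := by
  set K : Set (Fin (n + 1) → ℝ) := Icc 0 1 with hK
  set I : Set (Fin (n + 1) → ℝ) := pi univ fun _ => Ioo 0 1 with hI
  have hIo : IsOpen I := isOpen_set_pi finite_univ fun _ _ => isOpen_Ioo
  have hIK : I ⊆ K := fun x hx => ⟨fun i => (hx i trivial).1.le, fun i => (hx i trivial).2.le⟩
  have hKI : ∀ x ∈ I, K ∈ nhds x := fun x hx => Filter.mem_of_superset (hIo.mem_nhds hx) hIK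
  let T := fun x => fderivWithin ℝ (cubeExt c) K x
  let η := fun x => (β (cubeExt c x)).compContinuousLinearMap (T x)
  let e : Fin (n + 1) → Fin (n + 1) → ℝ := fun i => Pi.single i 1
  let f : Fin (n + 1) → (Fin (n + 1) → ℝ) → ℝ := fun i x => (-1 : ℝ) ^ (i : ℕ) • η x (i.removeNth e)
  have hf : ∀ i x, f i x = (-1 : ℝ) ^ (i : ℕ)
      • β (cubeExt c x) (i.removeNth (cubeTangent c x)) := fun i x => rfl
  have hβ' : ∀ p ∈ U, ContDiffAt ℝ ∞ β p := fun p hp => hβ.contDiffAt (hU.mem_nhds hp)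
  have hη : ∀ x ∈ I, DifferentiableAt ℝ η x := fun x hx =>
    DifferentiableAt.continuousAlternatingMapCompContinuousLinearMap
      (((hβ' _ (hcU _)).differentiableAt_infty).comp x
        ((hc.contDiffAt (hKI x hx)).differentiableAt (by simp)))
      ((hc.contDiffOn_fderivWithin.contDiffAt (hKI x hx)).differentiableAt (by simp))
  have hf' : ∀ x ∈ I, ∀ i, HasFDerivAt (f i)
      ((-1 : ℝ) ^ (i : ℕ) • fderiv ℝ (fun z => η z (i.removeNth e)) x) x := fun x hx i =>
    ((hη x hx).continuousAlternatingMap_apply_const (i.removeNth e)).hasFDerivAt.fun_const_smul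
      ((-1 : ℝ) ^ (i : ℕ))
  have hdiv : ∀ x ∈ I, ∑ i : Fin (n + 1),
      ((-1 : ℝ) ^ (i : ℕ) • fderiv ℝ (fun z => η z (i.removeNth e)) x) (e i)
      = extDeriv β (cubeExt c x) (cubeTangent c x) := by
    intro x hx
    have h1 := extDeriv_apply (hη x hx) e
    have h2 := extDerivWithin_pullback (t := univ) (s := K) (x := x) (r := ∞)
      (hβ' _ (hcU _)).differentiableAt_infty.differentiableWithinAt
      (hc x (hIK hx)) (by simpa using ENat.LEInfty.out) (uniqueDiffOn_cube (n + 1))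
      (subset_closure (mem_interior_iff_mem_nhds.2 (hKI x hx))) (hIK hx) (mapsTo_univ _ _)
    rw [extDerivWithin_univ, extDerivWithin, fderivWithin_of_mem_nhds (hKI x hx)] at h2
    have h3 : extDeriv η x = (extDeriv β (cubeExt c x)).compContinuousLinearMap (T x) := h2
    rw [h3] at h1
    refine Eq.trans (Finset.sum_congr rfl fun i _ => ?_) h1.symm
    simp
  have hcont : ContinuousOn (fun x => extDeriv β (cubeExt c x) (cubeTangent c x)) K :=
    hc.continuousOn_integrand hcU fun p hp =>
      (contDiffAt_extDeriv (hβ' p hp)).continuousAt.continuousWithinAt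
  have hae : (fun x => ∑ i : Fin (n + 1),
      ((-1 : ℝ) ^ (i : ℕ) • fderiv ℝ (fun z => η z (i.removeNth e)) x) (e i))
      =ᵐ[volume.restrict K] fun x => extDeriv β (cubeExt c x) (cubeTangent c x) := by
    rw [← Measure.restrict_congr_set (interior_ae_eq_cube (n + 1))]
    exact (ae_restrict_iff' hIo.measurableSet).2 (Filter.Eventually.of_forall hdiv)
  have hint := (hcont.integrableOn_compact isCompact_Icc (μ := volume)).congr hae.symm
  have main := integral_divergence_of_hasFDerivAt_off_countable' 0 1 (zero_le_one) f
    (fun i x => (-1 : ℝ) ^ (i : ℕ) • fderiv ℝ (fun z => η z (i.removeNth e)) x) ∅ countable_empty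
    (fun i => (((hβ.continuousOn.comp hc.continuousOn fun y _ => hcU _).eval
      (continuousOn_pi.2 fun j =>
        continuousOn_pi.1 hc.continuousOn_cubeTangent (i.succAbove j))).const_smul
        ((-1 : ℝ) ^ (i : ℕ)))) (fun x hx i => hf' x hx.1 i) hint
  rw [integral_congr_ae hae] at main
  rw [cubeIntegral, main, chainIntegral_cubeBoundary]
  refine Finset.sum_congr rfl fun i _ => ?_
  have hface : ∀ s : unitInterval, ∫ x in Icc (0 : Fin n → ℝ) 1, f i (i.insertNth (s : ℝ) x)
      = (-1) ^ (i : ℕ) * cubeIntegral (face c i s) β := by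
    intro s
    rw [cubeIntegral, ← integral_const_mul]
    refine setIntegral_congr_fun measurableSet_Icc fun x hx => ?_
    simp only [hf, smul_eq_mul]
    rw [cubeTangent_face hc i s hx, cubeExt_face]
    rfl
  have h0 := hface 0
  have h1 := hface 1
  rw [mul_sub, ← h0, ← h1]
  rfl

/-- **Stokes' theorem** for chains of smooth cubes in an open set. -/
theorem chainIntegral_extDeriv (hU : IsOpen U) {β : SpaceTime → SpaceTime [⋀^Fin n]→L[ℝ] ℝ}
    (hβ : ContDiffOn ℝ ∞ β U) {S : Chain (n + 1)}
    (hS : ∀ c ∈ S.support, IsSmoothCube c ∧ ∀ y, c y ∈ U) :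
    chainIntegral S (extDeriv β) = chainIntegral (boundary S) β := by
  rw [chainIntegral_boundary, chainIntegral]
  refine Finset.sum_congr rfl fun c hc => ?_
  dsimp only
  rw [cubeIntegral_extDeriv hU hβ (hS c hc).1 (hS c hc).2]

lemma cubeIntegral_congr {β γ : SpaceTime → SpaceTime [⋀^Fin n]→L[ℝ] ℝ} (c : SingularCube n)
    (h : ∀ y ∈ Icc (0 : Fin n → ℝ) 1,
      β (cubeExt c y) (cubeTangent c y) = γ (cubeExt c y) (cubeTangent c y)) :
    cubeIntegral c β = cubeIntegral c γ :=
  setIntegral_congr_fun measurableSet_Icc h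

lemma chainIntegral_congr {β γ : SpaceTime → SpaceTime [⋀^Fin n]→L[ℝ] ℝ} {S : Chain n}
    (hS : ∀ c ∈ S.support, ∀ y, c y ∈ U) (h : EqOn β γ U) :
    chainIntegral S β = chainIntegral S γ :=
  Finset.sum_congr rfl fun c hc => by
    dsimp only
    have hc' : ∀ y, cubeExt c y ∈ U := fun y => hS c hc _
    rw [cubeIntegral_congr (γ := γ) c fun y _ => by rw [h (hc' y)]]

lemma mem_support_boundary {S : Chain (n + 1)} {b : SingularCube n}
    (hb : b ∈ (boundary S).support) : ∃ c ∈ S.support, ∃ i s, b = face c i s := by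
  classical
  obtain ⟨c, hc, hbc⟩ := Finset.mem_biUnion.1 (Finsupp.support_sum hb)
  have h1 := Finsupp.support_smul hbc
  obtain ⟨i, -, hi⟩ := Finset.mem_biUnion.1 (Finsupp.support_finsetSum h1)
  have h2 := Finsupp.support_sub (Finsupp.support_smul hi)
  rcases Finset.mem_union.1 h2 with h | h
  · exact ⟨c, hc, i, 1, Finset.mem_singleton.1 (Finsupp.support_single_subset h)⟩
  · exact ⟨c, hc, i, 0, Finset.mem_singleton.1 (Finsupp.support_single_subset h)⟩

end Stokes

/-! ### The flow map in Lagrangian labels -/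

section Flow

variable {D : Set R3} {g : ℝ → R3 → R3} {v : SpaceTime → R3} {p : SpaceTime}

/-- The set `ℝ × D` of Lagrangian labels. -/
def labelDomain (D : Set R3) : Set SpaceTime := univ ×ˢ D

/-- The map `(t, x) ↦ (t, g_t(x))` from labels to the fluid domain. It conjugates the translations
in time to the advection, and maps the field `∂ₜ` to `∂ₜ + v`. -/
def flowMap (g : ℝ → R3 → R3) : SpaceTime → SpaceTime := fun p => (p.1, g p.1 p.2)

/-- The unit vector in the time direction. -/
def timeDir : SpaceTime := (1, 0)

lemma mem_labelDomain : p ∈ labelDomain D ↔ p.2 ∈ D := by simp [labelDomain]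

lemma add_timeDir (s : ℝ) (p : SpaceTime) : p + s • timeDir = (p.1 + s, p.2) := by
  ext <;> simp [timeDir]

lemma add_timeDir_mem (hp : p ∈ labelDomain D) (s : ℝ) : p + s • timeDir ∈ labelDomain D := by
  rw [mem_labelDomain, add_timeDir]
  exact mem_labelDomain.1 hp

lemma flowMap_mem (hp : p ∈ labelDomain D) : flowMap g p ∈ fluidDomain D g :=
  ⟨p.2, mem_labelDomain.1 hp, rfl⟩

lemma IsIncompressibleFlow.isOpen_labelDomain (hg : IsIncompressibleFlow D g v) :
    IsOpen (labelDomain D) :=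
  isOpen_univ.prod hg.isOpen

lemma IsIncompressibleFlow.contDiffAt_flowMap (hg : IsIncompressibleFlow D g v)
    (hp : p ∈ labelDomain D) : ContDiffAt ℝ ∞ (flowMap g) p :=
  contDiffAt_fst.prodMk (hg.smooth.contDiffAt (hg.isOpen_labelDomain.mem_nhds hp))

lemma IsIncompressibleFlow.fderiv_flowMap_timeDir (hg : IsIncompressibleFlow D g v)
    (hp : p ∈ labelDomain D) : fderiv ℝ (flowMap g) p timeDir = (1, v (flowMap g p)) := by
  have h1 : HasDerivAt (fun s : ℝ => ((s, p.2) : SpaceTime)) timeDir p.1 :=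
    (hasDerivAt_id p.1).prodMk (hasDerivAt_const p.1 p.2)
  have h2 : HasDerivAt (fun s : ℝ => flowMap g (s, p.2)) (fderiv ℝ (flowMap g) p timeDir) p.1 :=
    HasFDerivAt.comp_hasDerivAt (l := flowMap g) p.1
      (hg.contDiffAt_flowMap hp).differentiableAt_infty.hasFDerivAt h1
  have h3 : HasDerivAt (fun s : ℝ => flowMap g (s, p.2)) (1, v (flowMap g p)) p.1 :=
    (hasDerivAt_id p.1).prodMk (hg.velocity p.2 (mem_labelDomain.1 hp) p.1)
  exact h2.unique h3

lemma IsIncompressibleFlow.fderiv_flowMap_space (hg : IsIncompressibleFlow D g v)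
    (hp : p ∈ labelDomain D) (w : R3) :
    fderiv ℝ (flowMap g) p (0, w) = (0, fderiv ℝ (g p.1) p.2 w) := by
  have h1 : HasFDerivAt (fun y : R3 => ((p.1, y) : SpaceTime)) (ContinuousLinearMap.inr ℝ ℝ R3)
      p.2 := hasFDerivAt_prodMk_right p.1 p.2
  have h2 : HasFDerivAt (fun y : R3 => flowMap g (p.1, y))
      ((fderiv ℝ (flowMap g) p).comp (ContinuousLinearMap.inr ℝ ℝ R3)) p.2 :=
    HasFDerivAt.comp (g := flowMap g) p.2
      (hg.contDiffAt_flowMap hp).differentiableAt_infty.hasFDerivAt h1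
  have h3 : HasFDerivAt (fun y : R3 => (flowMap g (p.1, y)).2) _ p.2 := h2.snd
  have h4 : HasFDerivAt (fun y : R3 => (flowMap g (p.1, y)).1) _ p.2 := h2.fst
  have h5 : HasFDerivAt (fun y : R3 => (flowMap g (p.1, y)).1) (0 : R3 →L[ℝ] ℝ) p.2 :=
    hasFDerivAt_const p.1 p.2
  have h6 : fderiv ℝ (g p.1) p.2 = _ := h3.fderiv
  ext1
  · exact DFunLike.congr_fun (h4.unique h5) w
  · rw [h6]; rfl

/-- The flow map is a local diffeomorphism because `g_t` has Jacobian determinant one. -/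
lemma IsIncompressibleFlow.isOpen_fluidDomain (hg : IsIncompressibleFlow D g v) :
    IsOpen (fluidDomain D g) := by
  rw [isOpen_iff_mem_nhds]
  rintro ⟨t, z⟩ ⟨x, hx, hxz⟩
  have hp : ((t, x) : SpaceTime) ∈ labelDomain D := mem_labelDomain.2 hx
  have hz : (t, z) = flowMap g (t, x) := Prod.ext rfl hxz.symm
  have hsurj : (fderiv ℝ (flowMap g) (t, x)).range = ⊤ := by
    rw [LinearMap.range_eq_top]
    rintro ⟨s, y⟩
    have hdet : IsUnit (fderiv ℝ (g t) x).det := by simp [hg.volumePreserving t x hx]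
    obtain ⟨w, hw⟩ := (LinearMap.equivOfIsUnitDet
      (f := (fderiv ℝ (g t) x : R3 →ₗ[ℝ] R3)) hdet).surjective (y - s • v (flowMap g (t, x)))
    replace hw : fderiv ℝ (g t) x w = y - s • v (flowMap g (t, x)) := by simpa using hw
    refine ⟨s • timeDir + (0, w), ?_⟩
    change fderiv ℝ (flowMap g) (t, x) (s • timeDir + (0, w)) = _
    rw [map_add, map_smul, hg.fderiv_flowMap_timeDir hp, hg.fderiv_flowMap_space hp, hw]
    simp
  have hmap := ((hg.contDiffAt_flowMap hp).hasStrictFDerivAt (by simp)).map_nhds_eq_of_surj hsurj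
  rw [hz, ← hmap]
  exact Filter.mem_of_superset (Filter.image_mem_map (hg.isOpen_labelDomain.mem_nhds hp))
    (image_subset_iff.2 fun q hq => flowMap_mem hq)

lemma hasDerivAt_along_timeDir {V : Type*} [NormedAddCommGroup V] [NormedSpace ℝ V]
    {F : SpaceTime → V} {F' : SpaceTime →L[ℝ] V} {s : ℝ} (h : HasFDerivAt F F' (p + s • timeDir)) :
    HasDerivAt (fun s : ℝ => F (p + s • timeDir)) (F' timeDir) s := by
  have h1 : HasDerivAt (fun s : ℝ => p + s • timeDir) timeDir s := by
    simpa using ((hasDerivAt_id s).smul_const timeDir).const_add p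
  exact h.comp_hasDerivAt s h1

end Flow

/-! ### Transport of the forms `θ_k` -/

section Transport

variable {D : Set R3} {g : ℝ → R3 → R3} {v B : SpaceTime → R3} {φ h : SpaceTime → ℝ}
  {A : ℕ → SpaceTime → R3} {ψ : ℕ → SpaceTime → ℝ} {p : SpaceTime}

/-- The pullback of `θ_k` to Lagrangian labels. -/
def labelTheta (g : ℝ → R3 → R3) (A : ℕ → SpaceTime → R3) (ψ : ℕ → SpaceTime → ℝ) (k : ℕ) :
    SpaceTime → SpaceTime →L[ℝ] ℝ :=
  fun p => (theta A ψ k (flowMap g p)).comp (fderiv ℝ (flowMap g) p)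

/-- The pullback of `χ_k` to Lagrangian labels. -/
def labelChi (g : ℝ → R3 → R3) (v : SpaceTime → R3) (φ : SpaceTime → ℝ) (A : ℕ → SpaceTime → R3)
    (ψ : ℕ → SpaceTime → ℝ) (k : ℕ) : SpaceTime → ℝ :=
  fun p => chi v φ A ψ k (flowMap g p)

/-- The pullback of `dθ_k` to Lagrangian labels. -/
def labelDTheta (g : ℝ → R3 → R3) (A : ℕ → SpaceTime → R3) (ψ : ℕ → SpaceTime → ℝ) (k : ℕ) :
    SpaceTime → SpaceTime [⋀^Fin 2]→L[ℝ] ℝ :=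
  fun p => (dTheta A ψ k (flowMap g p)).compContinuousLinearMap (fderiv ℝ (flowMap g) p)

lemma contDiffAt_labelTheta (hg : IsIncompressibleFlow D g v)
    (hpot : ArePotentials (fluidDomain D g) v B φ h A ψ) (k : ℕ) (hp : p ∈ labelDomain D) :
    ContDiffAt ℝ ∞ (labelTheta g A ψ k) p :=
  ((hpot.contDiffAt_theta hg.isOpen_fluidDomain k (flowMap_mem hp)).comp p
    (hg.contDiffAt_flowMap hp)).clm_comp ((hg.contDiffAt_flowMap hp).fderiv_right (by simp))

lemma contDiffAt_labelChi (hg : IsIncompressibleFlow D g v)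
    (hs : IsFrozenSystem (fluidDomain D g) v B φ h)
    (hpot : ArePotentials (fluidDomain D g) v B φ h A ψ) (k : ℕ) (hp : p ∈ labelDomain D) :
    ContDiffAt ℝ ∞ (labelChi g v φ A ψ k) p :=
  (hpot.contDiffAt_chi hg.isOpen_fluidDomain hg.smooth_velocity hs k (flowMap_mem hp)).comp p
    (hg.contDiffAt_flowMap hp)

lemma fderiv_labelChi (hg : IsIncompressibleFlow D g v)
    (hs : IsFrozenSystem (fluidDomain D g) v B φ h)
    (hpot : ArePotentials (fluidDomain D g) v B φ h A ψ) (k : ℕ) (hp : p ∈ labelDomain D) :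
    fderiv ℝ (labelChi g v φ A ψ k) p
      = (fderiv ℝ (chi v φ A ψ k) (flowMap g p)).comp (fderiv ℝ (flowMap g) p) :=
  fderiv_comp p (hpot.contDiffAt_chi hg.isOpen_fluidDomain hg.smooth_velocity hs k
    (flowMap_mem hp)).differentiableAt_infty (hg.contDiffAt_flowMap hp).differentiableAt_infty

lemma extDeriv_labelTheta (hg : IsIncompressibleFlow D g v)
    (hpot : ArePotentials (fluidDomain D g) v B φ h A ψ) (k : ℕ) (hp : p ∈ labelDomain D) :
    extDeriv (toForm (labelTheta g A ψ k)) p = labelDTheta g A ψ k p := by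
  have h1 : toForm (labelTheta g A ψ k) = fun q =>
      (toForm (theta A ψ k) (flowMap g q)).compContinuousLinearMap (fderiv ℝ (flowMap g) q) := by
    ext q u
    simp [toForm_apply, labelTheta]
  rw [h1, extDeriv_pullback (contDiffAt_toForm (hpot.contDiffAt_theta hg.isOpen_fluidDomain k
    (flowMap_mem hp))).differentiableAt_infty (hg.contDiffAt_flowMap hp)
    (by simpa using ENat.LEInfty.out)]
  rfl

/-- Cartan's formula `L_{∂ₜ+v} θ_k = dχ_k`, written in Lagrangian labels, where `∂ₜ + v` is the
constant field `∂ₜ`. -/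
lemma fderiv_labelTheta_timeDir (hg : IsIncompressibleFlow D g v)
    (hs : IsFrozenSystem (fluidDomain D g) v B φ h)
    (hpot : ArePotentials (fluidDomain D g) v B φ h A ψ) (k : ℕ) (hp : p ∈ labelDomain D) :
    fderiv ℝ (labelTheta g A ψ k) p timeDir = fderiv ℝ (labelChi g v φ A ψ k) p := by
  have hU := hg.isOpen_fluidDomain
  have hq := flowMap_mem (g := g) hp
  have hF := hg.contDiffAt_flowMap hp
  refine ContinuousLinearMap.ext fun a => ?_
  have h1 := extDeriv_toForm_apply (p := p) (labelTheta g A ψ k) ![timeDir, a]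
  rw [extDeriv_labelTheta hg hpot k hp] at h1
  have h2 : labelDTheta g A ψ k p ![timeDir, a]
      = dTheta A ψ k (flowMap g p) ![(1, v (flowMap g p)), fderiv ℝ (flowMap g) p a] := by
    rw [labelDTheta, ContinuousAlternatingMap.compContinuousLinearMap_apply,
      ← hg.fderiv_flowMap_timeDir hp]
    congr 1
    ext i <;> fin_cases i <;> rfl
  have h3 : (fun q => labelTheta g A ψ k q timeDir)
      =ᶠ[nhds p] (fun q => theta A ψ k q (1, v q)) ∘ flowMap g :=
    Filter.eventually_of_mem (hg.isOpen_labelDomain.mem_nhds hp) fun q hq => by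
      simp [labelTheta, hg.fderiv_flowMap_timeDir hq]
  have hκ : ContDiffAt ℝ ∞ (fun q => theta A ψ k q (1, v q)) (flowMap g p) :=
    (hpot.contDiffAt_theta hU k hq).clm_apply
      (contDiffAt_const.prodMk (hg.smooth_velocity.contDiffAt (hU.mem_nhds hq)))
  have h4 : fderiv ℝ (labelTheta g A ψ k) p a timeDir
      = fderiv ℝ (fun q => theta A ψ k q (1, v q)) (flowMap g p) (fderiv ℝ (flowMap g) p a) := by
    have h5 : fderiv ℝ (fun q => labelTheta g A ψ k q timeDir) p a
        = fderiv ℝ (labelTheta g A ψ k) p a timeDir := by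
      rw [fderiv_clm_apply (contDiffAt_labelTheta hg hpot k hp).differentiableAt_infty
        (differentiableAt_const _)]
      simp
    rw [← h5, h3.fderiv_eq, fderiv_comp p hκ.differentiableAt_infty hF.differentiableAt_infty]
    rfl
  have h6 := hpot.dTheta_transport hU hg.smooth_velocity hs k hq (fderiv ℝ (flowMap g) p a)
  rw [fderiv_labelChi hg hs hpot k hp, ContinuousLinearMap.comp_apply, ← h6, ← h2, h1, ← h4]
  simp

lemma hasDerivAt_labelTheta (hg : IsIncompressibleFlow D g v)
    (hs : IsFrozenSystem (fluidDomain D g) v B φ h)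
    (hpot : ArePotentials (fluidDomain D g) v B φ h A ψ) (k : ℕ) (hp : p ∈ labelDomain D) (s : ℝ) :
    HasDerivAt (fun s : ℝ => labelTheta g A ψ k (p + s • timeDir))
      (fderiv ℝ (labelChi g v φ A ψ k) (p + s • timeDir)) s := by
  have hq := add_timeDir_mem hp s
  rw [← fderiv_labelTheta_timeDir hg hs hpot k hq]
  exact hasDerivAt_along_timeDir
    (contDiffAt_labelTheta hg hpot k hq).differentiableAt_infty.hasFDerivAt

/-- `dθ_k` is advected: in Lagrangian labels `∂ₜ dθ_k = d ∂ₜ θ_k = d dχ_k = 0`. -/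
lemma labelDTheta_add_timeDir (hg : IsIncompressibleFlow D g v)
    (hs : IsFrozenSystem (fluidDomain D g) v B φ h)
    (hpot : ArePotentials (fluidDomain D g) v B φ h A ψ) (k : ℕ) (hp : p ∈ labelDomain D) (s : ℝ) :
    labelDTheta g A ψ k (p + s • timeDir) = labelDTheta g A ψ k p := by
  ext u
  have hder : ∀ s : ℝ, HasDerivAt (fun s : ℝ => labelDTheta g A ψ k (p + s • timeDir) u) 0 s := by
    intro s
    have hq := add_timeDir_mem hp s
    have hθ := contDiffAt_labelTheta hg hpot k hq
    have hχ := contDiffAt_labelChi hg hs hpot k hq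
    have h1 : (fun q => fderiv ℝ (labelTheta g A ψ k) q timeDir)
        =ᶠ[nhds (p + s • timeDir)] fderiv ℝ (labelChi g v φ A ψ k) :=
      Filter.eventually_of_mem (hg.isOpen_labelDomain.mem_nhds hq) fun q hq =>
        fderiv_labelTheta_timeDir hg hs hpot k hq
    have h2 : ∀ a b, HasDerivAt
        (fun s : ℝ => fderiv ℝ (labelTheta g A ψ k) (p + s • timeDir) a b)
        (fderiv ℝ (fderiv ℝ (labelChi g v φ A ψ k)) (p + s • timeDir) a b) s := fun a b => by
      have h3 := hasDerivAt_along_timeDir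
        (contDiffAt_fderiv_apply hθ a).differentiableAt_infty.hasFDerivAt
      rw [fderiv_fderiv_apply hθ, fderiv_fderiv_symm hθ, ← fderiv_fderiv_apply hθ,
        h1.fderiv_eq] at h3
      simpa using h3.clm_apply (hasDerivAt_const s b)
    have h4 := (h2 (u 0) (u 1)).fun_sub (h2 (u 1) (u 0))
    rw [fderiv_fderiv_symm hχ, sub_self] at h4
    refine h4.congr_of_eventuallyEq (Filter.Eventually.of_forall fun r => ?_)
    simp only
    rw [← extDeriv_labelTheta hg hpot k (add_timeDir_mem hp r), extDeriv_toForm_apply]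
  have := is_const_of_deriv_eq_zero (fun s => (hder s).differentiableAt)
    (fun s => (hder s).deriv) s 0
  simpa using this

/-- The pullback of a form under the flow map, evaluated on vectors. -/
def labelEval {n : ℕ} (g : ℝ → R3 → R3) (β : SpaceTime → SpaceTime [⋀^Fin n]→L[ℝ] ℝ)
    (p : SpaceTime) (u : Fin n → SpaceTime) : ℝ :=
  β (flowMap g p) fun i => fderiv ℝ (flowMap g) p (u i)

lemma wedge_comp {n : ℕ} (α : SpaceTime →L[ℝ] ℝ) (β : SpaceTime [⋀^Fin n]→L[ℝ] ℝ)
    (L : SpaceTime →L[ℝ] SpaceTime) (u : Fin (n + 1) → SpaceTime) :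
    wedge (α.comp L) (β.compContinuousLinearMap L) u = wedge α β fun i => L (u i) := by
  simp only [wedge, ContinuousAlternatingMap.alternatizeUncurryFin_apply]
  rfl

/-- `L_{∂ₜ+v} (θ_k ∧ dθ_l) = dχ_k ∧ dθ_l` in Lagrangian labels. -/
lemma hasDerivAt_labelEval_helicityForm (hg : IsIncompressibleFlow D g v)
    (hs : IsFrozenSystem (fluidDomain D g) v B φ h)
    (hpot : ArePotentials (fluidDomain D g) v B φ h A ψ) (k l : ℕ) (hp : p ∈ labelDomain D)
    (u : Fin 3 → SpaceTime) (s : ℝ) :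
    HasDerivAt (fun s : ℝ => labelEval g (helicityForm A ψ k l) (p + s • timeDir) u)
      (labelEval g (fun q => wedge (fderiv ℝ (chi v φ A ψ k) q) (dTheta A ψ l q))
        (p + s • timeDir) u) s := by
  have h1 : ∀ s : ℝ, labelEval g (helicityForm A ψ k l) (p + s • timeDir) u
      = wedge (labelTheta g A ψ k (p + s • timeDir)) (labelDTheta g A ψ l p) u := fun s => by
    rw [← labelDTheta_add_timeDir hg hs hpot l hp s, labelTheta, labelDTheta, wedge_comp]
    rfl
  have h2 : labelEval g (fun q => wedge (fderiv ℝ (chi v φ A ψ k) q) (dTheta A ψ l q))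
        (p + s • timeDir) u
      = wedge (fderiv ℝ (labelChi g v φ A ψ k) (p + s • timeDir)) (labelDTheta g A ψ l p) u := by
    rw [← labelDTheta_add_timeDir hg hs hpot l hp s,
      fderiv_labelChi hg hs hpot k (add_timeDir_mem hp s), labelDTheta, wedge_comp]
    rfl
  have h3 : ∀ a, HasDerivAt (fun s : ℝ => labelTheta g A ψ k (p + s • timeDir) a)
      (fderiv ℝ (labelChi g v φ A ψ k) (p + s • timeDir) a) s := fun a => by
    simpa using (hasDerivAt_labelTheta hg hs hpot k hp s).clm_apply (hasDerivAt_const s a)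
  rw [funext h1, h2]
  simp only [wedge_apply_three]
  exact (((h3 (u 0)).mul_const _).fun_sub ((h3 (u 1)).mul_const _)).fun_add
    ((h3 (u 2)).mul_const _)

end Transport

/-! ### Integrals over advected regions -/

section Advection

open MeasureTheory

variable {D : Set R3} {g : ℝ → R3 → R3} {v : SpaceTime → R3} {n : ℕ}

/-- The cube at time `t` advected from the cube `c` in Lagrangian labels. -/
def advectCube (g : ℝ → R3 → R3) (t : ℝ) (c : SingularCube n) : SingularCube n :=
  fun y => ((c y).1 + t, g ((c y).1 + t) (c y).2)

lemma cubeExt_advectCube (t : ℝ) (c : SingularCube n) (y : Fin n → ℝ) :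
    cubeExt (advectCube g t c) y = flowMap g (cubeExt c y + t • timeDir) := by
  rw [add_timeDir]; rfl

lemma advectCube_mem {c : SingularCube n} (hcD : ∀ y, (c y).2 ∈ D) (t : ℝ)
    (y : Fin n → unitInterval) : advectCube g t c y ∈ fluidDomain D g :=
  ⟨(c y).2, hcD y, rfl⟩

lemma isSmoothCube_advectCube (hg : IsIncompressibleFlow D g v) {c : SingularCube n}
    (hc : IsSmoothCube c) (hcD : ∀ y, (c y).2 ∈ D) (t : ℝ) : IsSmoothCube (advectCube g t c) := by
  have h1 : cubeExt (advectCube g t c) = flowMap g ∘ fun y => cubeExt c y + t • timeDir :=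
    funext fun y => cubeExt_advectCube t c y
  rw [IsSmoothCube, h1]
  intro y hy
  have hq : cubeExt c y + t • timeDir ∈ labelDomain D :=
    add_timeDir_mem (mem_labelDomain.2 (hcD _)) t
  exact (hg.contDiffAt_flowMap hq).comp_contDiffWithinAt y ((hc y hy).add contDiffWithinAt_const)

lemma cubeTangent_advectCube (hg : IsIncompressibleFlow D g v) {c : SingularCube n}
    (hc : IsSmoothCube c) (hcD : ∀ y, (c y).2 ∈ D) (t : ℝ) {y : Fin n → ℝ}
    (hy : y ∈ Icc (0 : Fin n → ℝ) 1) (i : Fin n) :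
    cubeTangent (advectCube g t c) y i
      = fderiv ℝ (flowMap g) (cubeExt c y + t • timeDir) (cubeTangent c y i) := by
  have h1 : cubeExt (advectCube g t c) = flowMap g ∘ fun y => cubeExt c y + t • timeDir :=
    funext fun y => cubeExt_advectCube t c y
  have hq : cubeExt c y + t • timeDir ∈ labelDomain D :=
    add_timeDir_mem (mem_labelDomain.2 (hcD _)) t
  have h2 : HasFDerivWithinAt (fun y => cubeExt c y + t • timeDir)
      (fderivWithin ℝ (cubeExt c) (Icc 0 1) y) (Icc 0 1) y :=
    ((hc.differentiableOn (by simp)) y hy).hasFDerivWithinAt.add_const _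
  have h3 := HasFDerivAt.comp_hasFDerivWithinAt y
    (hg.contDiffAt_flowMap hq).differentiableAt_infty.hasFDerivAt h2
  rw [cubeTangent, h1, h3.fderivWithin (uniqueDiffOn_cube n y hy)]
  rfl

lemma cubeIntegral_advectCube (hg : IsIncompressibleFlow D g v) {c : SingularCube n}
    (hc : IsSmoothCube c) (hcD : ∀ y, (c y).2 ∈ D)
    (β : SpaceTime → SpaceTime [⋀^Fin n]→L[ℝ] ℝ) (t : ℝ) :
    cubeIntegral (advectCube g t c) β
      = ∫ y in Icc (0 : Fin n → ℝ) 1, labelEval g β (cubeExt c y + t • timeDir) (cubeTangent c y) :=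
  setIntegral_congr_fun measurableSet_Icc fun y hy => by
    simp only [labelEval]
    rw [cubeExt_advectCube, funext fun i => cubeTangent_advectCube hg hc hcD t hy i]

/-- The integrand over an advected cube is jointly continuous in time and position. -/
lemma continuousOn_labelEval (hg : IsIncompressibleFlow D g v) {c : SingularCube n}
    (hc : IsSmoothCube c) (hcD : ∀ y, (c y).2 ∈ D)
    {β : SpaceTime → SpaceTime [⋀^Fin n]→L[ℝ] ℝ} (hβ : ContinuousOn β (fluidDomain D g)) :
    ContinuousOn (fun z : ℝ × (Fin n → ℝ) =>
      labelEval g β (cubeExt c z.2 + z.1 • timeDir) (cubeTangent c z.2)) (univ ×ˢ Icc 0 1) := by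
  have hq : ∀ z : ℝ × (Fin n → ℝ), cubeExt c z.2 + z.1 • timeDir ∈ labelDomain D := fun z =>
    add_timeDir_mem (mem_labelDomain.2 (hcD _)) z.1
  have hsnd : MapsTo (Prod.snd : ℝ × (Fin n → ℝ) → Fin n → ℝ) (univ ×ˢ Icc 0 1) (Icc 0 1) :=
    fun z hz => hz.2
  have h1 : ContinuousOn (fun z : ℝ × (Fin n → ℝ) => cubeExt c z.2 + z.1 • timeDir)
      (univ ×ˢ Icc 0 1) :=
    (hc.continuousOn.comp continuousOn_snd hsnd).add (continuousOn_fst.smul continuousOn_const)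
  have h2 : ContinuousOn (flowMap g) (labelDomain D) := fun q hq =>
    (hg.contDiffAt_flowMap hq).continuousAt.continuousWithinAt
  have h3 : ContinuousOn (fderiv ℝ (flowMap g)) (labelDomain D) := fun q hq =>
    ((hg.contDiffAt_flowMap hq).fderiv_right (m := ∞) (by simp)).continuousAt.continuousWithinAt
  refine (hβ.comp (h2.comp h1 fun z _ => hq z) fun z _ => flowMap_mem (hq z)).eval
    (continuousOn_pi.2 fun i => ?_)
  exact (h3.comp h1 fun z _ => hq z).clm_apply
    ((continuousOn_pi.1 hc.continuousOn_cubeTangent i).comp continuousOn_snd hsnd)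

/-- Differentiation under the integral sign over an advected cube: if `β'` is the derivative of
`β` along the flow, then the integral of `β'` is the derivative of the integral of `β`. -/
lemma hasDerivAt_cubeIntegral_advectCube (hg : IsIncompressibleFlow D g v) {c : SingularCube n}
    (hc : IsSmoothCube c) (hcD : ∀ y, (c y).2 ∈ D)
    {β β' : SpaceTime → SpaceTime [⋀^Fin n]→L[ℝ] ℝ} (hβ : ContinuousOn β (fluidDomain D g))
    (hβ' : ContinuousOn β' (fluidDomain D g))
    (hder : ∀ p ∈ labelDomain D, ∀ u s,
      HasDerivAt (fun s : ℝ => labelEval g β (p + s • timeDir) u)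
        (labelEval g β' (p + s • timeDir) u) s) (t : ℝ) :
    HasDerivAt (fun s => cubeIntegral (advectCube g s c) β)
      (cubeIntegral (advectCube g t c) β') t := by
  simp only [cubeIntegral_advectCube hg hc hcD]
  have hcont := continuousOn_labelEval hg hc hcD hβ
  have hcont' := continuousOn_labelEval hg hc hcD hβ'
  have hslice : ∀ {F : ℝ × (Fin n → ℝ) → ℝ}, ContinuousOn F (univ ×ˢ Icc 0 1) → ∀ s,
      ContinuousOn (fun y => F (s, y)) (Icc 0 1) := fun hF s =>
    hF.comp (continuousOn_const.prodMk continuousOn_id) fun y hy => ⟨trivial, hy⟩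
  obtain ⟨C, hC⟩ := ((isCompact_Icc (a := t - 1) (b := t + 1)).prod
    (isCompact_Icc (a := (0 : Fin n → ℝ)) (b := 1))).exists_bound_of_continuousOn
    (hcont'.mono (prod_mono_left (subset_univ _)))
  refine (hasDerivAt_integral_of_dominated_loc_of_deriv_le
    (F := fun s y => labelEval g β (cubeExt c y + s • timeDir) (cubeTangent c y))
    (F' := fun s y => labelEval g β' (cubeExt c y + s • timeDir) (cubeTangent c y))
    (bound := fun _ => C) (Icc_mem_nhds (sub_one_lt t) (lt_add_one t))
    (Filter.Eventually.of_forall fun s =>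
      (hslice hcont s).aestronglyMeasurable measurableSet_Icc)
    ((hslice hcont t).integrableOn_compact isCompact_Icc)
    ((hslice hcont' t).aestronglyMeasurable measurableSet_Icc)
    ((ae_restrict_iff' measurableSet_Icc).2 (Filter.Eventually.of_forall fun y hy s hs =>
      hC (s, y) ⟨hs, hy⟩))
    (continuousOn_const.integrableOn_compact isCompact_Icc)
    (Filter.Eventually.of_forall fun y s _ => hder _ (mem_labelDomain.2 (hcD _)) _ s)).2

lemma chainIntegral_advect (t : ℝ) (S : Chain n) (β : SpaceTime → SpaceTime [⋀^Fin n]→L[ℝ] ℝ) :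
    chainIntegral (advect g t S) β
      = S.sum fun c m => (m : ℝ) * cubeIntegral (advectCube g t c) β :=
  Finsupp.sum_mapDomain_index (by simp) fun c m m' => by push_cast; ring

lemma mem_support_advect {t : ℝ} {S : Chain n} {b : SingularCube n}
    (hb : b ∈ (advect g t S).support) : ∃ c ∈ S.support, b = advectCube g t c := by
  classical
  obtain ⟨c, hc, h⟩ := Finset.mem_image.1 (Finsupp.mapDomain_support hb)
  exact ⟨c, hc, h.symm⟩

lemma advect_smooth (hg : IsIncompressibleFlow D g v) {S : Chain n} (hS : IsLabelRegion D S)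
    (t : ℝ) : ∀ c ∈ (advect g t S).support, IsSmoothCube c ∧ ∀ y, c y ∈ fluidDomain D g := by
  intro b hb
  obtain ⟨c, hc, rfl⟩ := mem_support_advect hb
  exact ⟨isSmoothCube_advectCube hg (hS c hc).1 (hS c hc).2 t, advectCube_mem (hS c hc).2 t⟩

lemma hasDerivAt_chainIntegral_advect (hg : IsIncompressibleFlow D g v) {S : Chain n}
    (hS : IsLabelRegion D S) {β β' : SpaceTime → SpaceTime [⋀^Fin n]→L[ℝ] ℝ}
    (hβ : ContinuousOn β (fluidDomain D g)) (hβ' : ContinuousOn β' (fluidDomain D g))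
    (hder : ∀ p ∈ labelDomain D, ∀ u s,
      HasDerivAt (fun s : ℝ => labelEval g β (p + s • timeDir) u)
        (labelEval g β' (p + s • timeDir) u) s) (t : ℝ) :
    HasDerivAt (fun s => chainIntegral (advect g s S) β) (chainIntegral (advect g t S) β') t := by
  simp only [chainIntegral_advect, Finsupp.sum]
  exact HasDerivAt.fun_sum fun c hc =>
    (hasDerivAt_cubeIntegral_advectCube hg (hS c hc).1 (hS c hc).2 hβ hβ' hder t).const_mul _

end Advection

/-! ### Circulation and helicity integrals -/

section Conservation

variable {n : ℕ} {D : Set R3} {g : ℝ → R3 → R3} {v B : SpaceTime → R3} {φ h : SpaceTime → ℝ}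
  {A : ℕ → SpaceTime → R3} {ψ : ℕ → SpaceTime → ℝ}

lemma chainIntegral_neg (S : Chain n) (β : SpaceTime → SpaceTime [⋀^Fin n]→L[ℝ] ℝ) :
    chainIntegral S (fun p => -β p) = -chainIntegral S β := by
  simp [chainIntegral, cubeIntegral, MeasureTheory.integral_neg, Finsupp.sum]

lemma chainIntegral_eq_zero {S : Chain n} {β : SpaceTime → SpaceTime [⋀^Fin n]→L[ℝ] ℝ}
    (h : ∀ c ∈ S.support, ∀ y ∈ Icc (0 : Fin n → ℝ) 1, β (cubeExt c y) (cubeTangent c y) = 0) :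
    chainIntegral S β = 0 :=
  Finset.sum_eq_zero fun c hc => by
    have h1 : cubeIntegral c β = 0 :=
      (MeasureTheory.setIntegral_congr_fun measurableSet_Icc (h c hc)).trans (by simp)
    simp [h1]

lemma boundary_mem {U : Set SpaceTime} {S : Chain (n + 1)}
    (hS : ∀ c ∈ S.support, IsSmoothCube c ∧ ∀ y, c y ∈ U) :
    ∀ b ∈ (boundary S).support, ∀ y, b y ∈ U := by
  intro b hb y
  obtain ⟨c, hc, i, s, rfl⟩ := mem_support_boundary hb
  exact (hS c hc).2 _

lemma hasDerivAt_integral_dTheta (hg : IsIncompressibleFlow D g v)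
    (hs : IsFrozenSystem (fluidDomain D g) v B φ h)
    (hpot : ArePotentials (fluidDomain D g) v B φ h A ψ) (k : ℕ) {S : Chain 2}
    (hS : IsLabelRegion D S) (t : ℝ) :
    HasDerivAt (fun s => chainIntegral (advect g s S) (dTheta A ψ k)) 0 t := by
  have h1 := hasDerivAt_chainIntegral_advect hg hS (β := dTheta A ψ k) (β' := fun _ => 0)
    (fun _ hp => (hpot.contDiffAt_dTheta hg.isOpen_fluidDomain k hp).continuousAt.continuousWithinAt)
    continuousOn_const (fun p hp u s => ?_) t
  · rwa [chainIntegral_eq_zero fun _ _ _ _ => rfl] at h1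
  · have h2 : (fun s : ℝ => labelEval g (dTheta A ψ k) (p + s • timeDir) u)
        = fun _ => labelDTheta g A ψ k p u := funext fun s => by
      rw [← labelDTheta_add_timeDir hg hs hpot k hp s]
      rfl
    rw [h2]
    exact hasDerivAt_const s _

lemma chainIntegral_dTheta (hg : IsIncompressibleFlow D g v)
    (hpot : ArePotentials (fluidDomain D g) v B φ h A ψ) (k : ℕ) {S : Chain 2}
    (hS : IsLabelRegion D S) (t : ℝ) :
    chainIntegral (advect g t S) (dTheta A ψ k)
      = chainIntegral (boundary (advect g t S)) (toForm (theta A ψ k)) :=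
  chainIntegral_extDeriv hg.isOpen_fluidDomain
    (contDiffOn_of_forall fun p hp =>
      contDiffAt_toForm (hpot.contDiffAt_theta hg.isOpen_fluidDomain k hp))
    (advect_smooth hg hS t)

lemma chainIntegral_Theta (hg : IsIncompressibleFlow D g v)
    (hs : IsFrozenSystem (fluidDomain D g) v B φ h)
    (hpot : ArePotentials (fluidDomain D g) v B φ h A ψ) (k : ℕ) {S : Chain 2}
    (hS : IsLabelRegion D S) (t : ℝ) :
    chainIntegral (advect g t S) (Theta v B φ h k)
      = -chainIntegral (advect g t S) (dTheta A ψ k) := by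
  rw [← chainIntegral_neg]
  exact chainIntegral_congr (fun c hc => (advect_smooth hg hS t c hc).2) fun p hp =>
    hpot.Theta_eq hg.isOpen_fluidDomain hs k hp

lemma chainIntegral_boundary_dChi (hg : IsIncompressibleFlow D g v)
    (hs : IsFrozenSystem (fluidDomain D g) v B φ h)
    (hpot : ArePotentials (fluidDomain D g) v B φ h A ψ) (k : ℕ) {S : Chain 2}
    (hS : IsLabelRegion D S) (t : ℝ) :
    chainIntegral (boundary (advect g t S)) (toForm (fderiv ℝ (chi v φ A ψ k))) = 0 := by
  have hχ := fun p hp =>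
    hpot.contDiffAt_chi (p := p) hg.isOpen_fluidDomain hg.smooth_velocity hs k hp
  rw [← chainIntegral_extDeriv hg.isOpen_fluidDomain (contDiffOn_of_forall fun p hp =>
    contDiffAt_toForm ((hχ p hp).fderiv_right (by simp))) (advect_smooth hg hS t)]
  refine chainIntegral_eq_zero fun c hc y _ => ?_
  have hy : cubeExt c y ∈ fluidDomain D g := (advect_smooth hg hS t c hc).2 _
  rw [extDeriv_toForm_fderiv (hχ _ hy)]
  rfl

/-- The rate of change of the helicity is the integral of `dχ_k ∧ dθ_l = d(χ_k dθ_l)`. -/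
lemma hasDerivAt_integral_helicityForm (hg : IsIncompressibleFlow D g v)
    (hs : IsFrozenSystem (fluidDomain D g) v B φ h)
    (hpot : ArePotentials (fluidDomain D g) v B φ h A ψ) (k l : ℕ) {c : Chain 3}
    (hc : IsLabelRegion D c) (t : ℝ) :
    HasDerivAt (fun s => chainIntegral (advect g s c) (helicityForm A ψ k l))
      (chainIntegral (boundary (advect g t c)) fun p => chi v φ A ψ k p • dTheta A ψ l p) t := by
  have hU := hg.isOpen_fluidDomain
  have hχ := fun p hp => hpot.contDiffAt_chi (p := p) hU hg.smooth_velocity hs k hp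
  have hd := fun p hp => hpot.contDiffAt_dTheta (p := p) hU l hp
  have hχd : ContDiffOn ℝ ∞ (fun p => chi v φ A ψ k p • dTheta A ψ l p) (fluidDomain D g) :=
    contDiffOn_of_forall fun p hp => (hχ p hp).smul (hd p hp)
  have hwedge : ∀ (α : SpaceTime → SpaceTime →L[ℝ] ℝ)
      (β : SpaceTime → SpaceTime [⋀^Fin 2]→L[ℝ] ℝ), ContinuousOn α (fluidDomain D g) →
      ContinuousOn β (fluidDomain D g) →
      ContinuousOn (fun p => wedge (α p) (β p)) (fluidDomain D g) := fun α β hα hβ =>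
    (ContinuousAlternatingMap.alternatizeUncurryFinCLM ℝ SpaceTime ℝ).continuous.comp_continuousOn
      ((((ContinuousLinearMap.smulRightL ℝ SpaceTime
        (SpaceTime [⋀^Fin 2]→L[ℝ] ℝ)).continuous.comp_continuousOn hα)).clm_apply hβ)
  have hdc : ContinuousOn (dTheta A ψ l) (fluidDomain D g) := fun p hp =>
    (hd p hp).continuousAt.continuousWithinAt
  have h1 := hasDerivAt_chainIntegral_advect hg hc (β := helicityForm A ψ k l)
    (β' := fun q => wedge (fderiv ℝ (chi v φ A ψ k) q) (dTheta A ψ l q))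
    (hwedge _ _ (fun p hp => (hpot.contDiffAt_theta hU k hp).continuousAt.continuousWithinAt) hdc)
    (hwedge _ _ (fun p hp =>
      ((hχ p hp).fderiv_right (m := ∞) (by simp)).continuousAt.continuousWithinAt) hdc)
    (fun p hp u s => hasDerivAt_labelEval_helicityForm hg hs hpot k l hp u s) t
  rw [← chainIntegral_extDeriv hU hχd (advect_smooth hg hc t)]
  convert h1 using 1
  refine chainIntegral_congr (fun c' hc' => (advect_smooth hg hc t c' hc').2) fun p hp => ?_
  rw [extDeriv_smul_fun (hχ p hp) (hd p hp), dTheta, extDeriv_extDeriv_eq_zero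
    (contDiffAt_toForm (hpot.contDiffAt_theta hU l hp)), smul_zero, add_zero]

/-- Integration by parts on the boundary: `dχ_k ∧ θ_l` and `-χ_k dθ_l` differ by the exact form
`d(χ_k θ_l)`, hence have the same exterior derivative. -/
lemma chainIntegral_boundary_chi_dTheta (hg : IsIncompressibleFlow D g v)
    (hs : IsFrozenSystem (fluidDomain D g) v B φ h)
    (hpot : ArePotentials (fluidDomain D g) v B φ h A ψ) (k l : ℕ) {c : Chain 3}
    (hc : IsLabelRegion D c) (t : ℝ) :
    (chainIntegral (boundary (advect g t c)) fun p => chi v φ A ψ k p • dTheta A ψ l p)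
      = -(chainIntegral (boundary (advect g t c)) fun p =>
            wedge₁ (fderiv ℝ (chi v φ A ψ k) p) (theta A ψ l p)) := by
  have hU := hg.isOpen_fluidDomain
  have hχ := fun p hp => hpot.contDiffAt_chi (p := p) hU hg.smooth_velocity hs k hp
  have hθ := fun p hp => contDiffAt_toForm (hpot.contDiffAt_theta (p := p) hU l hp)
  have hχd : ∀ p ∈ fluidDomain D g,
      ContDiffAt ℝ ∞ (fun q => chi v φ A ψ k q • dTheta A ψ l q) p := fun p hp =>
    (hχ p hp).smul (hpot.contDiffAt_dTheta hU l hp)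
  have hex : ∀ p ∈ fluidDomain D g,
      ContDiffAt ℝ ∞ (extDeriv fun q => chi v φ A ψ k q • toForm (theta A ψ l) q) p := fun p hp =>
    contDiffAt_extDeriv ((hχ p hp).smul (hθ p hp))
  have hS := advect_smooth hg hc t
  have heq : EqOn (fun p => wedge₁ (fderiv ℝ (chi v φ A ψ k) p) (theta A ψ l p))
      (fun p => extDeriv (fun q => chi v φ A ψ k q • toForm (theta A ψ l) q) p
        + (-1 : ℝ) • (chi v φ A ψ k p • dTheta A ψ l p)) (fluidDomain D g) := fun p hp => by
    simp only
    rw [extDeriv_smul_fun (hχ p hp) (hθ p hp)]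
    ext u
    simp only [ContinuousAlternatingMap.add_apply, ContinuousAlternatingMap.smul_apply, smul_eq_mul,
      wedge₁, dTheta, toForm]
    ring
  rw [chainIntegral_congr (boundary_mem hS) heq,
    ← chainIntegral_extDeriv hU (contDiffOn_of_forall hχd) hS,
    ← chainIntegral_extDeriv hU (contDiffOn_of_forall fun p hp =>
      (hex p hp).add ((hχd p hp).const_smul (-1 : ℝ))) hS, ← chainIntegral_neg]
  refine chainIntegral_congr (fun c' hc' => (hS c' hc').2) fun p hp => ?_
  have h1 := extDeriv_fun_add (hex p hp).differentiableAt_infty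
    ((hχd p hp).const_smul (-1 : ℝ)).differentiableAt_infty
  have h2 := extDeriv_smul (x := p) (-1 : ℝ) (fun q => chi v φ A ψ k q • dTheta A ψ l q)
  have h3 : extDeriv (extDeriv fun q => chi v φ A ψ k q • toForm (theta A ψ l) q) p = 0 :=
    extDeriv_extDeriv_eq_zero ((hχ p hp).smul (hθ p hp))
  rw [h1, h3, zero_add]
  change _ = -extDeriv ((-1 : ℝ) • fun q => chi v φ A ψ k q • dTheta A ψ l q) p
  rw [h2]
  ext u
  simp

/-- On a dependent pair every two-form vanishes. On an independent pair with `û` in its spatial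
plane, the part `û · dx ∧ dx` is zero; the part in `dx ∧ dt` is zero because `dt` is, or, for
`l ≥ 1`, because its coefficient is `± û × v`, which is normal to the plane when `v` is tangent
as well. -/
lemma dTheta_eq_zero_of_tangent {U : Set SpaceTime} (hU : IsOpen U)
    (hs : IsFrozenSystem U v B φ h) (hpot : ArePotentials U v B φ h A ψ) (l : ℕ) {p : SpaceTime}
    (hp : p ∈ U) (u : Fin 2 → SpaceTime)
    (hu : LinearIndependent ℝ u →
      symmetryField B φ h l p ∈ Submodule.span ℝ (range fun j => (u j).2))
    (hv : (∀ j, (u j).1 = 0) ∨ (1 ≤ l ∧ (LinearIndependent ℝ u →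
      v p ∈ Submodule.span ℝ (range fun j => (u j).2)))) :
    dTheta A ψ l p u = 0 := by
  by_cases hind : LinearIndependent ℝ u
  · obtain ⟨a, ha⟩ := (Submodule.mem_span_range_iff_exists_fun ℝ).1 (hu hind)
    rw [Fin.sum_univ_two] at ha
    have hT : ∀ a : SpaceTime, dT a = a.1 := fun _ => rfl
    rcases hv with h0 | ⟨hl, hv⟩
    · rw [hpot.dTheta_eq hU l hp, ← ha]
      simp only [ContinuousAlternatingMap.add_apply, ContinuousAlternatingMap.smul_apply,
        wedge₁_apply, dotDx_apply, dotDxDx_apply, hT, h0, add_dotProduct, smul_dotProduct,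
        dot_self_cross, dot_cross_self]
      simp
    · obtain ⟨b, hb⟩ := (Submodule.mem_span_range_iff_exists_fun ℝ).1 (hv hind)
      rw [Fin.sum_univ_two] at hb
      obtain ⟨l, rfl⟩ : ∃ m, l = m + 1 := ⟨l - 1, by omega⟩
      have h1 := hpot.Theta_eq hU hs (l + 1) hp
      rw [← neg_eq_zero, ← ContinuousAlternatingMap.neg_apply, ← h1]
      simp only [Theta, cross, ContinuousAlternatingMap.sub_apply,
        ContinuousAlternatingMap.neg_apply, wedge₁_apply, dotDx_apply, dotDxDx_apply, hT]
      rw [← ha, ← hb]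
      simp only [dotProduct, Fin.sum_univ_three, cross_apply, Matrix.cons_val, Pi.add_apply,
        Pi.smul_apply, smul_eq_mul]
      ring
  · exact (dTheta A ψ l p).toAlternatingMap.map_linearDependent u hind

lemma cubeTangent_fst_eq_zero {c : SingularCube n} {τ : ℝ} (hτ : ∀ y, (c y).1 = τ)
    {y : Fin n → ℝ} (hy : y ∈ Icc (0 : Fin n → ℝ) 1) (i : Fin n) :
    (cubeTangent c y i).1 = 0 := by
  rw [cubeTangent]
  by_cases hd : DifferentiableWithinAt ℝ (cubeExt c) (Icc 0 1) y
  · have h1 := hd.hasFDerivWithinAt.fst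
    have h2 : HasFDerivWithinAt (fun y => (cubeExt c y).1) (0 : (Fin n → ℝ) →L[ℝ] ℝ)
        (Icc 0 1) y := by
      have : (fun y => (cubeExt c y).1) = fun _ => τ := funext fun y => hτ _
      rw [this]
      exact hasFDerivWithinAt_const τ y _
    exact DFunLike.congr_fun ((uniqueDiffOn_cube n y hy).eq h1 h2) (Pi.single i 1)
  · rw [fderivWithin_zero_of_not_differentiableWithinAt hd]
    rfl

lemma chainIntegral_boundary_chi_dTheta_eq_zero (hg : IsIncompressibleFlow D g v)
    (hs : IsFrozenSystem (fluidDomain D g) v B φ h)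
    (hpot : ArePotentials (fluidDomain D g) v B φ h A ψ) (k l : ℕ) {c : Chain 3}
    (hc : IsLabelRegion D c) (t : ℝ)
    (htan : TangentToProjection (symmetryField B φ h l) (boundary (advect g t c)))
    (hcase : InTimeSlice c ∨ (1 ≤ l ∧ TangentToProjection v (boundary (advect g t c)))) :
    (chainIntegral (boundary (advect g t c)) fun p => chi v φ A ψ k p • dTheta A ψ l p) = 0 := by
  refine chainIntegral_eq_zero fun b hb y hy => ?_
  have hbU := boundary_mem (advect_smooth hg hc t) b hb
  let z : Fin 2 → unitInterval := fun i => ⟨y i, hy.1 i, hy.2 i⟩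
  have hz : b z = cubeExt b y := (cubeExt_eq b hy).symm
  have h1 := dTheta_eq_zero_of_tangent hg.isOpen_fluidDomain hs hpot l
    (hbU z) (cubeTangent b y) (htan b hb z) ?_
  · rw [hz] at h1
    rw [ContinuousAlternatingMap.smul_apply, h1, smul_zero]
  · rcases hcase with ⟨τ, hτ⟩ | ⟨hl, hv⟩
    · refine Or.inl (cubeTangent_fst_eq_zero (τ := τ + t) (fun x => ?_) hy)
      obtain ⟨c', hc', i, s, rfl⟩ := mem_support_boundary hb
      obtain ⟨c₀, hc₀, rfl⟩ := mem_support_advect hc'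
      exact congrArg (· + t) (hτ c₀ hc₀ _)
    · exact Or.inr ⟨hl, hv b hb z⟩

/-- If `χ_k` is constant, the boundary term `∮ dχ_k ∧ θ_l` vanishes. -/
lemma chainIntegral_boundary_chi_dTheta_eq_zero_of_const (hg : IsIncompressibleFlow D g v)
    (hs : IsFrozenSystem (fluidDomain D g) v B φ h)
    (hpot : ArePotentials (fluidDomain D g) v B φ h A ψ) (k l : ℕ) {c : Chain 3}
    (hc : IsLabelRegion D c) (t : ℝ) {a : ℝ} (ha : ∀ p ∈ fluidDomain D g, chi v φ A ψ k p = a) :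
    (chainIntegral (boundary (advect g t c)) fun p => chi v φ A ψ k p • dTheta A ψ l p) = 0 := by
  rw [chainIntegral_boundary_chi_dTheta hg hs hpot k l hc t, neg_eq_zero]
  refine chainIntegral_eq_zero fun b hb y _ => ?_
  have hbU : cubeExt b y ∈ fluidDomain D g := boundary_mem (advect_smooth hg hc t) b hb _
  have h1 : chi v φ A ψ k =ᶠ[nhds (cubeExt b y)] fun _ => a :=
    Filter.eventually_of_mem (hg.isOpen_fluidDomain.mem_nhds hbU) ha
  rw [wedge₁_apply, h1.fderiv_eq]
  simp

end Conservation

end VorticityConservation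

end

open VorticityConservation in
theorem proposition3
    (D : Set R3) (g : ℝ → R3 → R3) (v B : SpaceTime → R3) (φ h : SpaceTime → ℝ)
    (A : ℕ → SpaceTime → R3) (ψ : ℕ → SpaceTime → ℝ)
    (hflow : IsIncompressibleFlow D g v)
    (hfields : IsFrozenSystem (fluidDomain D g) v B φ h)
    (hpot : ArePotentials (fluidDomain D g) v B φ h A ψ) :
    -- the two-forms are exact, `Θ_k = - dθ_k`, with `Θ₀ = Ω`
    (∀ k, ∀ p ∈ fluidDomain D g, Theta v B φ h k p = -dTheta A ψ k p) ∧
    -- (1) general vorticity conservation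
    (∀ k, ∀ S : Chain 2, IsLabelRegion D S → ∀ t : ℝ,
      HasDerivAt (fun s => chainIntegral (advect g s S) (Theta v B φ h k)) 0 t ∧
      chainIntegral (advect g t S) (Theta v B φ h k)
        = -chainIntegral (boundary (advect g t S)) (toForm (theta A ψ k)) ∧
      HasDerivAt
        (fun s => chainIntegral (boundary (advect g s S)) (toForm (theta A ψ k)))
        (chainIntegral (boundary (advect g t S)) (toForm (fderiv ℝ (chi v φ A ψ k)))) t ∧
      chainIntegral (boundary (advect g t S)) (toForm (fderiv ℝ (chi v φ A ψ k))) = 0) ∧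
    -- (2) general helicity conservation
    (∀ k l, ∀ c : Chain 3, IsLabelRegion D c → ∀ t : ℝ,
      HasDerivAt (fun s => chainIntegral (advect g s c) (helicityForm A ψ k l))
        (chainIntegral (boundary (advect g t c)) fun p => chi v φ A ψ k p • dTheta A ψ l p) t ∧
      (chainIntegral (boundary (advect g t c)) fun p => chi v φ A ψ k p • dTheta A ψ l p)
        = -(chainIntegral (boundary (advect g t c)) fun p =>
              wedge₁ (fderiv ℝ (chi v φ A ψ k) p) (theta A ψ l p)) ∧
      ((TangentToProjection (symmetryField B φ h l) (boundary (advect g t c)) ∧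
            (InTimeSlice c ∨
              (1 ≤ l ∧ TangentToProjection v (boundary (advect g t c))))) ∨
          (∃ a : ℝ, ∀ p ∈ fluidDomain D g, chi v φ A ψ k p = a) →
        HasDerivAt (fun s => chainIntegral (advect g s c) (helicityForm A ψ k l)) 0 t)) ∧
    -- (3) Lagrangian invariants and the Poisson algebra of generalized potential vorticities
    (∀ k l, (∀ p ∈ fluidDomain D g, symmetryField B φ h l p ⬝ᵥ grad (chi v φ A ψ k) p = 0) →
      IsLagrangianInvariant (fluidDomain D g) v (helicityDensity A ψ k l)) ∧
    (IsPoissonAlgebra (fluidDomain D g) φ {f | IsLagrangianInvariant (fluidDomain D g) v f} ∧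
      ∀ j, IsLagrangianInvariant (fluidDomain D g) v (potVort B φ h j)) ∧
    (∀ j l, EqOn (A (j + 1)) (explicitPotential B φ h j) (fluidDomain D g) →
      ∀ S : Set (SpaceTime → ℝ), IsPoissonAlgebra (fluidDomain D g) φ S → φ ∈ S →
        (∀ i, potVort B φ h i ∈ S) → helicityDensity A ψ (j + 1) l ∈ S) := by
  have hU := hflow.isOpen_fluidDomain
  have hv := hflow.smooth_velocity
  have hdiv : ∀ p ∈ fluidDomain D g, divergence v p = 0 := fun p hp =>
    hfields.divergence_eq_zero hU hv hp
  refine ⟨fun k p hp => hpot.Theta_eq hU hfields k hp, fun k S hS t => ?_, fun k l c hc t => ?_,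
    fun k l => hpot.helicityDensity_invariant hU hv hfields k l,
    ⟨isPoissonAlgebra_invariants hU hv hdiv hfields.conserved_φ,
      hpot.potVort_invariant hU hv hfields⟩,
    fun j l hA S hS hφ hp => hpot.helicityDensity_mem hU hfields j l hA hS hφ hp⟩
  · have h1 := hasDerivAt_integral_dTheta hflow hfields hpot k hS t
    have h2 := chainIntegral_boundary_dChi hflow hfields hpot k hS t
    refine ⟨?_, ?_, ?_, h2⟩
    · simpa only [chainIntegral_Theta hflow hfields hpot k hS, neg_zero] using h1.fun_neg
    · rw [chainIntegral_Theta hflow hfields hpot k hS, chainIntegral_dTheta hflow hpot k hS]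
    · simpa only [h2, chainIntegral_dTheta hflow hpot k hS] using h1
  · have h1 := hasDerivAt_integral_helicityForm hflow hfields hpot k l hc t
    refine ⟨h1, chainIntegral_boundary_chi_dTheta hflow hfields hpot k l hc t, fun hcase => ?_⟩
    rcases hcase with ⟨htan, hcase⟩ | ⟨a, ha⟩
    · rwa [chainIntegral_boundary_chi_dTheta_eq_zero hflow hfields hpot k l hc t htan hcase] at h1
    · rwa [chainIntegral_boundary_chi_dTheta_eq_zero_of_const hflow hfields hpot k l hc t ha] at h1
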